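/- Work in ZFC. For a cardinal $\theta$ let $H(\theta)$ be the set of all sets whose transitive closure has size less than $\theta$. A *weak $\kappa$-model* is a (not necessarily transitive) set $M$ of size $\kappa$ with $\kappa+1\subseteq M$ and $\langle M,\in\rangle\models\mathsf{ZFC}^-$, that is, ZFC without the powerset axiom, with the collection scheme in place of replacement and with choice in the form that every set can be well-ordered; it is a *$\kappa$-model* if moreover $M^{<\kappa}\subseteq M$. An elementary embedding $j\colon M\to N$ of a weak $\kappa$-model $M$ into a transitive set $N$ is *$\kappa$-powerset preserving* if it has critical point $\kappa$ and $M$ and $N$ have the same subsets of $\kappa$. A cardinal $\kappa$ is *super Ramsey* (respectively *super weakly Ramsey*) if every $A\subseteq\kappa$ is an element of some $\kappa$-model (respectively weak $\kappa$-model) $M\prec H(\kappa^+)$ for which there is a $\kappa$-powerset preserving elementary embedding $j\colon M\to N$. For regular (infinite) cardinals $\alpha\le\kappa$, $\kappa$ is *$\alpha$-Ramsey* if for arbitrarily large regular cardinals $\theta$, every $A\subseteq\kappa$ is an element of some weak $\kappa$-model $M\prec H(\theta)$ which is closed under ${<}\alpha$-sequences and for which there is a $\kappa$-powerset preserving elementary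 embedding $j\colon M\to N$. **Proposition 5.2.** (1) If $\kappa$ is $\kappa$-Ramsey, then $\kappa$ is super Ramsey and a limit of super Ramsey cardinals, i.e. for every cardinal $\mu<\kappa$ there is a super Ramsey cardinal $\nu$ with $\mu<\nu<\kappa$. (2) If $\kappa$ is $\omega$-Ramsey, then $\kappa$ is super weakly Ramsey and a limit of super weakly Ramsey cardinals. -/

import Mathlib

universe u

namespace RamseyLike

open FirstOrder

/-! ### The language of set theory, and sets of sets as structures for it -/

/-- The only symbol of the language of set theory: the binary membership relation. -/
inductive MemRel : ℕ → Type
  | mem : MemRel 2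

/-- The first-order language of set theory, with one binary relation symbol. -/
def setLang : FirstOrder.Language.{0, 0} := ⟨fun _ => Empty, MemRel⟩

/-- A set (or class) of sets is a structure for the language of set theory, in which the relation
symbol is interpreted as the true membership relation. In particular every `M : ZFSet` gives the
structure `⟨M, ∈⟩`. -/
instance memStructure (p : ZFSet.{u} → Prop) : setLang.Structure {x : ZFSet.{u} // p x} where
  funMap := fun f => Empty.elim f
  RelMap := fun {_} r => match r with
    | MemRel.mem => fun v => (v 0).1 ∈ (v 1).1

/-! ### The theory ZFC without the powerset axiom -/

section ZFCMinus

variable {X : Type*} [setLang.Structure X]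

/-- The interpretation of the membership symbol in a structure. -/
def Mem (x y : X) : Prop := FirstOrder.Language.Structure.RelMap (L := setLang) MemRel.mem ![x, y]

/-- In the structure `X`, `d` is the unordered pair of `x` and `y`. -/
def IsUPair (d x y : X) : Prop := ∀ z : X, Mem z d ↔ z = x ∨ z = y

/-- In the structure `X`, `p` is the (Kuratowski) ordered pair of `x` and `y`. -/
def IsOPair (p x y : X) : Prop := ∃ s d : X, IsUPair s x x ∧ IsUPair d x y ∧ IsUPair p s d

/-- In the structure `X`, the ordered pair of `x` and `y` is an element of `r`. -/
def Rel (r x y : X) : Prop := ∃ p : X, IsOPair p x y ∧ Mem p r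

variable (X) in
/-- `X ⊨ ZFC⁻`: the structure `X` satisfies ZFC without the powerset axiom, with the scheme of
collection rather than replacement, and choice as the principle that every set can be
well-ordered. The two schemes range over all first-order formulas with parameters. -/
structure ModelsZFCMinus : Prop where
  extensionality : ∀ a b : X, (∀ z, Mem z a ↔ Mem z b) → a = b
  foundation : ∀ a : X, (∃ x, Mem x a) → ∃ x, Mem x a ∧ ∀ y, Mem y x → ¬ Mem y a
  pairing : ∀ a b : X, ∃ d, IsUPair d a b
  union : ∀ a : X, ∃ b, ∀ x, Mem x b ↔ ∃ y, Mem y a ∧ Mem x y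
  infinity : ∃ w : X, (∃ e, Mem e w ∧ ∀ z, ¬ Mem z e) ∧
    ∀ x, Mem x w → ∃ y, Mem y w ∧ ∀ z, Mem z y ↔ Mem z x ∨ z = x
  separation : ∀ (n : ℕ) (φ : setLang.Formula (Fin (n + 1))) (p : Fin n → X) (a : X),
    ∃ b : X, ∀ x, Mem x b ↔ Mem x a ∧ φ.Realize (Fin.cons x p : Fin (n + 1) → X)
  collection : ∀ (n : ℕ) (φ : setLang.Formula (Fin (n + 2))) (p : Fin n → X) (a : X),
    (∀ x, Mem x a → ∃ y : X, φ.Realize (Fin.cons x (Fin.cons y p) : Fin (n + 2) → X)) →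
    ∃ b : X, ∀ x, Mem x a →
      ∃ y, Mem y b ∧ φ.Realize (Fin.cons x (Fin.cons y p) : Fin (n + 2) → X)
  wellOrdering : ∀ a : X, ∃ r : X,
    (∀ x, Mem x a → ¬ Rel r x x) ∧
    (∀ x y z, Mem x a → Mem y a → Mem z a → Rel r x y → Rel r y z → Rel r x z) ∧
    (∀ x y, Mem x a → Mem y a → Rel r x y ∨ x = y ∨ Rel r y x) ∧
    ∀ b : X, (∀ x, Mem x b → Mem x a) → (∃ x, Mem x b) →
      ∃ x, Mem x b ∧ ∀ y, Mem y b → y ≠ x → Rel r x y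

end ZFCMinus

/-! ### The sets `H(θ)` and elementary substructures -/

/-- The von Neumann cardinal (the initial ordinal of `κ`) as a set. -/
noncomputable def cardSet (κ : Cardinal.{u}) : ZFSet.{u} := κ.ord.toZFSet

/-- `H(θ)`, the set of all sets whose transitive closure has size less than `θ`, that is, of all
sets which are included in a transitive set of size less than `θ`. All of them lie in `V_θ`, see
`mem_H`. -/
noncomputable def H (θ : Cardinal.{u}) : ZFSet.{u} :=
  ZFSet.sep (fun x => ∃ t : ZFSet.{u}, t.IsTransitive ∧ x ⊆ t ∧ t.card < θ)
    (ZFSet.vonNeumann θ.ord)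

/-- The rank of a transitive set of size less than `θ` is less than `θ`. -/
theorem rank_lt_of_card_lt {θ : Cardinal.{u}} {t : ZFSet.{u}} (ht : t.IsTransitive)
    (hc : t.card < θ) : t.rank < θ.ord := by
  have key : ∀ (n : Ordinal.{u}) (y : ZFSet.{u}), y.rank = n → (y ∈ t ∨ y = t) →
      ∀ a < y.rank, ∃ z ∈ t, z.rank = a := by
    intro n
    induction n using WellFoundedLT.induction with
    | ind n ih =>
      intro y hy hyt a ha
      obtain ⟨z, hz, haz⟩ := ZFSet.lt_rank_iff.1 ha
      have hzt : z ∈ t := by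
        rcases hyt with h | h
        · exact ht y h hz
        · exact h ▸ hz
      rcases haz.lt_or_eq with h | h
      · exact ih z.rank (hy ▸ ZFSet.rank_lt_of_mem hz) z rfl (Or.inl hzt) a h
      · exact ⟨z, hzt, h.symm⟩
  have hsub : Set.Iio t.rank ⊆ ZFSet.rank '' (t : Set ZFSet.{u}) := by
    intro a ha
    obtain ⟨z, hz, h⟩ := key _ t rfl (Or.inr rfl) a ha
    exact ⟨z, hz, h⟩
  have h1 := (Cardinal.mk_le_mk_of_subset hsub).trans Cardinal.mk_image_le
  rw [Cardinal.mk_Iio_ordinal] at h1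
  have h2 : Cardinal.lift.{u + 1} t.rank.card ≤ Cardinal.lift.{u + 1} t.card :=
    h1.trans_eq ZFSet.cardinalMk_coe_sort
  exact Cardinal.lt_ord.2 ((Cardinal.lift_le.1 h2).trans_lt hc)

theorem mem_H {θ : Cardinal.{u}} {x : ZFSet.{u}} :
    x ∈ H θ ↔ ∃ t : ZFSet.{u}, t.IsTransitive ∧ x ⊆ t ∧ t.card < θ := by
  rw [H, ZFSet.mem_sep, ZFSet.mem_vonNeumann]
  refine ⟨fun h => h.2, fun h => ⟨?_, h⟩⟩
  obtain ⟨t, ht, hx, hc⟩ := h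
  exact (ZFSet.rank_mono hx).trans_lt (rank_lt_of_card_lt ht hc)

/-- `M ≺ K`: the structure `⟨M, ∈⟩` is an elementary substructure of `⟨K, ∈⟩`, that is, `M ⊆ K`
and the inclusion is an elementary embedding. -/
def ElemSub (M K : ZFSet.{u}) : Prop := ∃ i : M ↪ₑ[setLang] K, ∀ x : M, (i x : ZFSet.{u}) = x

/-! ### Weak `κ`-models and powerset preserving embeddings -/

/-- A weak `κ`-model is a set `M` of size `κ` with `κ + 1 ⊆ M` and `⟨M, ∈⟩ ⊨ ZFC⁻`. It need not be
transitive. -/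
structure IsWeakModel (κ : Cardinal.{u}) (M : ZFSet.{u}) : Prop where
  card_eq : M.card = κ
  subset : cardSet κ ⊆ M
  mem : cardSet κ ∈ M
  models : ModelsZFCMinus M

/-- `M` is closed under `<α`-sequences: every function (as a set of ordered pairs) from an ordinal
below `α` to `M` is an element of `M`. -/
def ClosedUnderSeq (α : Cardinal.{u}) (M : ZFSet.{u}) : Prop :=
  ∀ β < α.ord, ∀ f : ZFSet.{u}, ZFSet.IsFunc β.toZFSet M f → f ∈ M

/-- A `κ`-model is a weak `κ`-model `M` with `M^{<κ} ⊆ M`. -/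
def IsModel (κ : Cardinal.{u}) (M : ZFSet.{u}) : Prop := IsWeakModel κ M ∧ ClosedUnderSeq κ M

/-- The elementary embedding `j : M → N` is `κ`-powerset preserving: `κ` is its critical point (the
least ordinal moved), and `M` and `N` have the same subsets of `κ`. -/
structure PowersetPreserving (κ : Cardinal.{u}) {M N : ZFSet.{u}} (j : M ↪ₑ[setLang] N) :
    Prop where
  fixes : ∀ x : M, (x : ZFSet.{u}) ∈ cardSet κ → (j x : ZFSet.{u}) = x
  moves : ∃ x : M, (x : ZFSet.{u}) = cardSet κ ∧ (j x : ZFSet.{u}) ≠ x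
  same_subsets : ∀ A : ZFSet.{u}, A ⊆ cardSet κ → (A ∈ M ↔ A ∈ N)

/-- There is a `κ`-powerset preserving elementary embedding `j : M → N`. The target is a
transitive set; well-founded targets can be replaced by their transitive collapse. -/
def HasPowersetPreservingEmbedding (κ : Cardinal.{u}) (M : ZFSet.{u}) : Prop :=
  ∃ N : ZFSet.{u}, N.IsTransitive ∧ ∃ j : M ↪ₑ[setLang] N, PowersetPreserving κ j

/-! ### The large cardinals -/

/-- `κ` is super Ramsey. -/
def SuperRamsey (κ : Cardinal.{u}) : Prop :=
  ∀ A : ZFSet.{u}, A ⊆ cardSet κ → ∃ M : ZFSet.{u}, A ∈ M ∧ IsModel κ M ∧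
    ElemSub M (H (Order.succ κ)) ∧ HasPowersetPreservingEmbedding κ M

/-- `κ` is super weakly Ramsey. -/
def SuperWeaklyRamsey (κ : Cardinal.{u}) : Prop :=
  ∀ A : ZFSet.{u}, A ⊆ cardSet κ → ∃ M : ZFSet.{u}, A ∈ M ∧ IsWeakModel κ M ∧
    ElemSub M (H (Order.succ κ)) ∧ HasPowersetPreservingEmbedding κ M

/-- `κ` is `α`-Ramsey, for regular cardinals `α ≤ κ` (regular cardinals are infinite): for
arbitrarily large regular cardinals `θ`, every `A ⊆ κ` is an element of some weak `κ`-model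
`M ≺ H(θ)` which is closed under `<α`-sequences and has a `κ`-powerset preserving embedding. -/
def AlphaRamsey (α κ : Cardinal.{u}) : Prop :=
  α.IsRegular ∧ κ.IsRegular ∧ α ≤ κ ∧
    ∀ μ : Cardinal.{u}, ∃ θ : Cardinal.{u}, μ ≤ θ ∧ θ.IsRegular ∧
      ∀ A : ZFSet.{u}, A ⊆ cardSet κ → ∃ M : ZFSet.{u}, A ∈ M ∧ IsWeakModel κ M ∧
        ElemSub M (H θ) ∧ ClosedUnderSeq α M ∧ HasPowersetPreservingEmbedding κ M

/-- `κ` is a limit of cardinals with property `P`: such cardinals are unbounded below `κ`. -/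
def IsLimitOf (P : Cardinal.{u} → Prop) (κ : Cardinal.{u}) : Prop :=
  ∀ μ < κ, ∃ ν, μ < ν ∧ ν < κ ∧ P ν

end RamseyLike

/-!
Take `M ≺ H(θ)` and `j : M → N` witnessing that `κ` is `α`-Ramsey, for a large regular `θ`. The set
`M ∩ H(κ⁺)` is transitive, an elementary substructure of `H(κ⁺)`, and a restriction of `j` to it is
still powerset preserving, so it witnesses that `κ` is super Ramsey up to closure under
`<α`-sequences.

For the limit property, powerset preservation gives `M ∩ H(κ⁺) = H(κ⁺)^N`. By elementarity the
models and embeddings for the sets `A ∈ M` can be found in `M`; after a Löwenheim–Skolem argument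
the target of the embedding has size `κ` as well, so that these witnesses lie in
`M ∩ H(κ⁺) ⊆ N`. Hence `N` believes that `κ < j(κ)` has the property in question. By elementarity
`H(θ)` believes that such cardinals are unbounded below `κ`, and it is right about this. To make
all of this first-order, elementarity of embeddings is expressed through satisfaction relations,
which are elements of `H(θ)`.
-/

namespace RamseyLike

open FirstOrder

/-! ### Uniform definability over transitive sets -/

theorem mem_iff {p : ZFSet.{u} → Prop} (x y : {x // p x}) : Mem x y ↔ x.1 ∈ y.1 := Iff.rfl

/-- The membership symbol, with its arity in the form which `FirstOrder.Language` expects. -/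
abbrev memSym : setLang.Relations 2 := MemRel.mem

/-- One formula expresses `P W v` in all structures `⟨W, ∈⟩` with `W` transitive, at all points `v`
of `W`. This is a class in order that such formulas are found by instance search. -/
class UniformlyDefinable {α : Type} (P : ZFSet.{u} → (α → ZFSet.{u}) → Prop) : Prop where
  exists_formula : ∃ φ : setLang.Formula α, ∀ W : ZFSet.{u}, W.IsTransitive →
    ∀ v : α → W, φ.Realize v ↔ P W (fun a => v a)

/-- The graph of `T` is uniformly definable; the additional variable `none` stands for the value.
The value need not belong to the transitive set in which the formula is evaluated. -/
class DefinableTerm {α : Type} (T : (α → ZFSet.{u}) → ZFSet.{u}) : Prop where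
  definable_graph :
    UniformlyDefinable (fun _ (v : Option α → ZFSet.{u}) => v none = T (fun a => v (some a)))

namespace UniformlyDefinable

variable {α β : Type} {P Q : ZFSet.{u} → (α → ZFSet.{u}) → Prop}

theorem congr (hP : UniformlyDefinable P)
    (h : ∀ W : ZFSet.{u}, W.IsTransitive → ∀ v : α → ZFSet.{u},
      (∀ a, v a ∈ W) → (P W v ↔ Q W v)) : UniformlyDefinable Q := by
  obtain ⟨φ, hφ⟩ := hP
  exact ⟨φ, fun W hW v => (hφ W hW v).trans (h W hW _ fun a => (v a).2)⟩

theorem comap (f : α → β) (hP : UniformlyDefinable P) :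
    UniformlyDefinable (fun W (v : β → ZFSet.{u}) => P W (fun a => v (f a))) := by
  obtain ⟨φ, hφ⟩ := hP
  refine ⟨φ.relabel f, fun W hW v => ?_⟩
  rw [Language.Formula.realize_relabel, hφ W hW]
  rfl

instance false : UniformlyDefinable (fun (_ : ZFSet.{u}) (_ : α → ZFSet.{u}) => False) :=
  ⟨⊥, fun _ _ _ => Language.Formula.realize_bot⟩

instance imp [hP : UniformlyDefinable P] [hQ : UniformlyDefinable Q] :
    UniformlyDefinable (fun W v => P W v → Q W v) := by
  obtain ⟨φ, hφ⟩ := hP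
  obtain ⟨ψ, hψ⟩ := hQ
  exact ⟨φ.imp ψ, fun W hW v => by rw [Language.Formula.realize_imp, hφ W hW, hψ W hW]⟩

instance not [UniformlyDefinable P] : UniformlyDefinable (fun W v => ¬ P W v) :=
  inferInstanceAs (UniformlyDefinable fun W v => P W v → False)

instance and [hP : UniformlyDefinable P] [hQ : UniformlyDefinable Q] :
    UniformlyDefinable (fun W v => P W v ∧ Q W v) := by
  obtain ⟨φ, hφ⟩ := hP
  obtain ⟨ψ, hψ⟩ := hQ
  exact ⟨φ ⊓ ψ, fun W hW v => by rw [Language.Formula.realize_inf, hφ W hW, hψ W hW]⟩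

instance or [hP : UniformlyDefinable P] [hQ : UniformlyDefinable Q] :
    UniformlyDefinable (fun W v => P W v ∨ Q W v) := by
  obtain ⟨φ, hφ⟩ := hP
  obtain ⟨ψ, hψ⟩ := hQ
  exact ⟨φ ⊔ ψ, fun W hW v => by rw [Language.Formula.realize_sup, hφ W hW, hψ W hW]⟩

instance iff [hP : UniformlyDefinable P] [hQ : UniformlyDefinable Q] :
    UniformlyDefinable (fun W v => P W v ↔ Q W v) := by
  obtain ⟨φ, hφ⟩ := hP
  obtain ⟨ψ, hψ⟩ := hQ
  exact ⟨φ.iff ψ, fun W hW v => by rw [Language.Formula.realize_iff, hφ W hW, hψ W hW]⟩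

instance forall_fin {n : ℕ} {R : Fin n → ZFSet.{u} → (α → ZFSet.{u}) → Prop}
    [hR : ∀ k, UniformlyDefinable (R k)] : UniformlyDefinable (fun W v => ∀ k, R k W v) := by
  choose φ hφ using fun k => (hR k).exists_formula
  refine ⟨Language.Formula.iInf φ, fun W hW v => ?_⟩
  rw [Language.Formula.realize_iInf]
  exact forall_congr' fun k => hφ k W hW v

instance mem_var {a b : α} : UniformlyDefinable (fun (_ : ZFSet.{u}) v => v a ∈ v b) :=
  ⟨memSym.formula₂ (.var a) (.var b), fun W _ v => by
    rw [Language.Formula.realize_rel₂]; exact Iff.rfl⟩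

instance eq_var {a b : α} : UniformlyDefinable (fun (_ : ZFSet.{u}) v => v a = v b) :=
  ⟨Language.Term.equal (.var a) (.var b), fun W _ v => by
    rw [Language.Formula.realize_equal]; exact Subtype.ext_iff⟩

section Quantifier

variable {R : ZFSet.{u} → ZFSet.{u} → (α → ZFSet.{u}) → Prop}
  [hR : UniformlyDefinable (fun W (v : Option α → ZFSet.{u}) =>
    R (v none) W (fun a => v (some a)))]
include hR

instance all : UniformlyDefinable (fun W v => ∀ x ∈ W, R x W v) := by
  obtain ⟨φ, hφ⟩ := hR
  refine ⟨(φ.relabel (fun o : Option α => o.elim (Sum.inr ()) Sum.inl)).iAlls Unit,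
    fun W hW v => ?_⟩
  simp only [Language.Formula.realize_iAlls, Language.Formula.realize_relabel, hφ W hW]
  exact ⟨fun h x hx => h fun _ => ⟨x, hx⟩, fun h i => h _ (i ()).2⟩

instance ex : UniformlyDefinable (fun W v => ∃ x ∈ W, R x W v) := by
  have : UniformlyDefinable (fun W v => ¬ ∀ x ∈ W, ¬ R x W v) := inferInstance
  exact this.congr fun W _ v _ => by push Not; rfl

instance ball {a : α} : UniformlyDefinable (fun W v => ∀ x ∈ v a, R x W v) := by
  have : UniformlyDefinable (fun W v => ∀ x ∈ W, x ∈ v a → R x W v) := inferInstance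
  exact this.congr fun _ hW _ hv =>
    ⟨fun h x hx => h x (hW _ (hv a) hx) hx, fun h x _ hx => h x hx⟩

instance bex {a : α} : UniformlyDefinable (fun W v => ∃ x ∈ v a, R x W v) := by
  have : UniformlyDefinable (fun W v => ¬ ∀ x ∈ v a, ¬ R x W v) := inferInstance
  exact this.congr fun W _ v _ => by push Not; rfl

end Quantifier

variable {a b : α} {T : (α → ZFSet.{u}) → ZFSet.{u}}

instance eq_term [hT : DefinableTerm T] : UniformlyDefinable (fun _ v => v a = T v) :=
  hT.definable_graph.comap (fun o : Option α => o.elim a id)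

instance mem_term [hT : DefinableTerm T] : UniformlyDefinable (fun _ v => T v ∈ v a) := by
  have := hT.definable_graph
  have : UniformlyDefinable (fun _ v => ∃ x ∈ v a, x = T v) := inferInstance
  exact this.congr fun W _ v _ => by simp only [exists_eq_right]

instance subset : UniformlyDefinable (fun (_ : ZFSet.{u}) v => v a ⊆ v b) :=
  inferInstanceAs (UniformlyDefinable fun _ v => ∀ x ∈ v a, x ∈ v b)

instance isTransitive : UniformlyDefinable (fun (_ : ZFSet.{u}) v => (v a).IsTransitive) :=
  inferInstanceAs (UniformlyDefinable (fun _ v => ∀ y ∈ v a, y ⊆ v a))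

instance isOrdinal : UniformlyDefinable (fun (_ : ZFSet.{u}) v => (v a).IsOrdinal) := by
  simp only [ZFSet.isOrdinal_iff_forall_mem_isTransitive]
  infer_instance

end UniformlyDefinable

namespace DefinableTerm

variable {α : Type} {S T : (α → ZFSet.{u}) → ZFSet.{u}}

instance var {a : α} : DefinableTerm (fun v : α → ZFSet.{u} => v a) := ⟨inferInstance⟩

instance empty : DefinableTerm (fun _ : α → ZFSet.{u} => ∅) := by
  constructor
  have : UniformlyDefinable (fun _ (v : Option α → ZFSet.{u}) => ∀ x ∈ v none, False) :=
    inferInstance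
  exact this.congr fun W _ v _ => by rw [ZFSet.eq_empty]

instance upair [hS : DefinableTerm S] [hT : DefinableTerm T] :
    DefinableTerm (fun v => {S v, T v}) := by
  constructor
  have eq_S := hS.definable_graph.comap
    (fun o => o.elim (some none) fun a => some (some (some a)) :
      Option α → Option (Option (Option α)))
  have eq_T := hT.definable_graph.comap
    (fun o => o.elim none fun a => some (some (some a)) : Option α → Option (Option (Option α)))
  dsimp only [Option.elim] at eq_S eq_T
  have : UniformlyDefinable (fun _ (v : Option α → ZFSet.{u}) => ∃ x ∈ v none, ∃ y ∈ v none,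
      (∀ z ∈ v none, z = x ∨ z = y) ∧ x = S (fun a => v (some a)) ∧
        y = T (fun a => v (some a))) := inferInstance
  refine this.congr fun W _ v _ => ?_
  constructor
  · rintro ⟨x, hx, y, hy, h, rfl, rfl⟩
    ext z
    rw [ZFSet.mem_pair]
    exact ⟨h z, by rintro (rfl | rfl) <;> assumption⟩
  · intro h
    simp [h]

instance pair [DefinableTerm S] [DefinableTerm T] :
    DefinableTerm (fun v => ZFSet.pair (S v) (T v)) := by
  have : DefinableTerm (fun v => {{S v, S v}, {S v, T v}}) := inferInstance
  simp only [ZFSet.pair_eq_singleton] at this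
  exact this

end DefinableTerm

/-! ### Realization of formulas in sets -/

section RealizeIn

variable {n : ℕ} {X : ZFSet.{u}} {v : Fin n → ZFSet.{u}}

/-- The formula `φ` holds in the structure `⟨X, ∈⟩` at the points `v`, which belong to `X`. -/
def RealizeIn (φ : setLang.BoundedFormula Empty n) (X : ZFSet.{u}) (v : Fin n → ZFSet.{u}) : Prop :=
  ∃ h : ∀ i, v i ∈ X, φ.Realize (M := X) default (fun i => ⟨v i, h i⟩)

theorem setLang_induction {motive : ∀ n, setLang.BoundedFormula Empty n → Prop}
    (falsum : ∀ n, motive n .falsum)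
    (equal : ∀ n (i k : Fin n), motive n (.equal (.var (.inr i)) (.var (.inr k))))
    (mem : ∀ n (i k : Fin n) (ts : Fin 2 → setLang.Term (Empty ⊕ Fin n)),
      ts 0 = .var (.inr i) → ts 1 = .var (.inr k) → motive n (.rel memSym ts))
    (imp : ∀ n φ ψ, motive n φ → motive n ψ → motive n (.imp φ ψ))
    (all : ∀ n φ, motive (n + 1) φ → motive n (.all φ)) :
    ∀ n (φ : setLang.BoundedFormula Empty n), motive n φ := by
  have term_eq_var : ∀ n (t : setLang.Term (Empty ⊕ Fin n)), ∃ i, t = .var (.inr i) := by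
    rintro n (⟨e | i⟩ | f)
    · exact e.elim
    · exact ⟨i, rfl⟩
    · exact Empty.elim f
  intro n φ
  induction φ with
  | falsum => exact falsum _
  | equal t₁ t₂ =>
    obtain ⟨i, rfl⟩ := term_eq_var _ t₁
    obtain ⟨k, rfl⟩ := term_eq_var _ t₂
    exact equal _ i k
  | rel R ts =>
    cases R
    obtain ⟨i, hi⟩ := term_eq_var _ (ts 0)
    obtain ⟨k, hk⟩ := term_eq_var _ (ts 1)
    exact mem _ i k ts hi hk
  | imp φ ψ hφ hψ => exact imp _ _ _ hφ hψ
  | all φ h => exact all _ _ h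

theorem realizeIn_iff {φ : setLang.BoundedFormula Empty n} (v : Fin n → X) :
    RealizeIn φ X (fun i => v i) ↔ φ.Realize default v :=
  ⟨fun h => h.2, fun h => ⟨fun i => (v i).2, h⟩⟩

theorem realizeIn_relabel {φ : setLang.Formula (Fin n)} (v : Fin n → X) :
    RealizeIn (Language.BoundedFormula.relabel Sum.inr φ) X (fun i => v i) ↔ φ.Realize v := by
  exact (realizeIn_iff v).trans (Language.Formula.realize_relabel_sumInr φ)

theorem realizeIn_falsum : ¬ RealizeIn .falsum X v := fun h => h.2

theorem realizeIn_equal (i k : Fin n) :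
    RealizeIn (.equal (.var (.inr i)) (.var (.inr k))) X v ↔ (∀ i, v i ∈ X) ∧ v i = v k := by
  constructor
  · rintro ⟨h, e⟩
    exact ⟨h, congrArg Subtype.val e⟩
  · rintro ⟨h, e⟩
    exact ⟨h, Subtype.ext e⟩

theorem realizeIn_mem (i k : Fin n) (ts : Fin 2 → setLang.Term (Empty ⊕ Fin n))
    (hi : ts 0 = .var (.inr i)) (hk : ts 1 = .var (.inr k)) :
    RealizeIn (.rel memSym ts) X v ↔ (∀ i, v i ∈ X) ∧ v i ∈ v k := by
  have realize_iff : ∀ h : ∀ i, v i ∈ X,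
      (Language.BoundedFormula.rel memSym ts).Realize (M := X) default (fun i => ⟨v i, h i⟩) ↔
        v i ∈ v k := by
    intro h
    change ((ts 0).realize _ : X).1 ∈ ((ts 1).realize _ : X).1 ↔ _
    rw [hi, hk]
    rfl
  exact ⟨fun ⟨h, e⟩ => ⟨h, (realize_iff h).1 e⟩, fun ⟨h, e⟩ => ⟨h, (realize_iff h).2 e⟩⟩

theorem realizeIn_imp (φ ψ : setLang.BoundedFormula Empty n) :
    RealizeIn (.imp φ ψ) X v ↔ (∀ i, v i ∈ X) ∧ (RealizeIn φ X v → RealizeIn ψ X v) :=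
  ⟨fun ⟨h, e⟩ => ⟨h, fun ⟨_, e'⟩ => ⟨h, e e'⟩⟩, fun ⟨h, e⟩ => ⟨h, fun e' => (e ⟨h, e'⟩).2⟩⟩

theorem coe_snoc (v : Fin n → X) (x : X) :
    (fun i => ((Fin.snoc v x : Fin (n + 1) → X) i : ZFSet.{u})) =
      Fin.snoc (fun i => (v i : ZFSet.{u})) x.1 :=
  Fin.comp_snoc Subtype.val v x

theorem realizeIn_all (φ : setLang.BoundedFormula Empty (n + 1)) :
    RealizeIn (.all φ) X v ↔ (∀ i, v i ∈ X) ∧ ∀ x ∈ X, RealizeIn φ X (Fin.snoc v x) := by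
  have realizeIn_snoc_iff (h : ∀ i, v i ∈ X) (x : X) : RealizeIn φ X (Fin.snoc v x.1) ↔
      φ.Realize default (Fin.snoc (fun i => ⟨v i, h i⟩) x : Fin (n + 1) → X) := by
    rw [← realizeIn_iff, coe_snoc]
  exact ⟨fun ⟨h, e⟩ => ⟨h, fun x hx => (realizeIn_snoc_iff h ⟨x, hx⟩).2 (e ⟨x, hx⟩)⟩,
    fun ⟨h, e⟩ => ⟨h, fun x => (realizeIn_snoc_iff h x).1 (e x x.2)⟩⟩

theorem snoc_mem {x : ZFSet.{u}} (hv : ∀ i, v i ∈ X) (hx : x ∈ X) :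
    ∀ i, (Fin.snoc v x : Fin (n + 1) → ZFSet.{u}) i ∈ X :=
  Fin.forall_fin_succ'.2 ⟨fun i => by simpa using hv i, by simpa using hx⟩

end RealizeIn

namespace UniformlyDefinable

variable {n : ℕ} {α : Type}

theorem snoc {P : ZFSet.{u} → ZFSet.{u} → (Fin (n + 1) → ZFSet.{u}) → Prop} {f : Fin n → α}
    {a b : α}
    (h : UniformlyDefinable fun W v => P W (v a) fun i => v ((Fin.snoc f b : Fin (n + 1) → α) i)) :
    UniformlyDefinable fun W v => P W (v a) (Fin.snoc (fun i => v (f i)) (v b)) :=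
  h.congr fun W _ v _ => iff_of_eq <| congrArg (P W (v a)) (Fin.comp_snoc v f b)

instance realizeIn {φ : setLang.BoundedFormula Empty n} {f : Fin n → α} {a : α} :
    UniformlyDefinable (fun (_ : ZFSet.{u}) v => RealizeIn φ (v a) (fun i => v (f i))) := by
  induction n, φ using setLang_induction generalizing α with
  | falsum n => simpa only [realizeIn_falsum] using UniformlyDefinable.false
  | equal n i k =>
    simp only [realizeIn_equal]
    infer_instance
  | mem n i k ts hi hk =>
    simp only [realizeIn_mem i k ts hi hk]
    infer_instance
  | imp n φ ψ hφ hψ =>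
    simp only [realizeIn_imp]
    infer_instance
  | all n φ h =>
    have := snoc (P := fun _ => RealizeIn φ)
      (h (f := Fin.snoc (fun i => some (f i)) none) (a := some a))
    simp only [realizeIn_all]
    infer_instance

instance realizeIn_ambient {φ : setLang.BoundedFormula Empty n} {f : Fin n → α} :
    UniformlyDefinable (fun (W : ZFSet.{u}) v => RealizeIn φ W (fun i => v (f i))) := by
  refine ⟨φ.toFormula.relabel (Sum.elim Empty.elim f), fun W _ v => ?_⟩
  rw [Language.Formula.realize_relabel, Language.BoundedFormula.realize_toFormula,
    realizeIn_iff fun i => v (f i)]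
  exact iff_of_eq (congrArg₂ _ (Subsingleton.elim _ _) rfl)

end UniformlyDefinable

/-! ### Elementary substructures and embeddings -/

section Elementary

variable {M N K X : ZFSet.{u}} {α : Type}

/-- The extension of `j` to all sets by the empty set. -/
noncomputable def app (j : M ↪ₑ[setLang] N) (x : ZFSet.{u}) : ZFSet.{u} :=
  open Classical in if h : x ∈ M then j ⟨x, h⟩ else ∅

theorem app_of_mem (j : M ↪ₑ[setLang] N) {x : ZFSet.{u}} (h : x ∈ M) : app j x = j ⟨x, h⟩ :=
  dif_pos h

theorem app_mem (j : M ↪ₑ[setLang] N) {x : ZFSet.{u}} (h : x ∈ M) : app j x ∈ N := by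
  rw [app_of_mem j h]
  exact (j _).2

theorem realizeIn_app (j : M ↪ₑ[setLang] N) {n : ℕ} (φ : setLang.BoundedFormula Empty n)
    {v : Fin n → ZFSet.{u}} (hv : ∀ i, v i ∈ M) :
    RealizeIn φ M v ↔ RealizeIn φ N (fun i => app j (v i)) := by
  let w : Fin n → M := fun i => ⟨v i, hv i⟩
  have app_eq : (fun i => app j (v i)) = fun i => ((j ∘ w) i : ZFSet.{u}) :=
    funext fun i => app_of_mem j (hv i)
  have map_iff := j.map_boundedFormula φ default w
  rw [Subsingleton.elim (j ∘ default) default] at map_iff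
  rw [app_eq, realizeIn_iff, map_iff, ← realizeIn_iff]

theorem exists_elementaryEmbedding (F : ZFSet.{u} → ZFSet.{u}) (hF : ∀ x ∈ M, F x ∈ N)
    (h : ∀ (n : ℕ) (φ : setLang.BoundedFormula Empty n) (v : Fin n → ZFSet.{u}), (∀ i, v i ∈ M) →
      (RealizeIn φ M v ↔ RealizeIn φ N (fun i => F (v i)))) :
    ∃ j : M ↪ₑ[setLang] N, ∀ x : M, (j x : ZFSet.{u}) = F x := by
  refine ⟨⟨fun x => ⟨F x, hF x x.2⟩, fun n φ x => ?_⟩, fun x => rfl⟩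
  rw [← realizeIn_relabel, ← realizeIn_relabel]
  exact (h n _ (fun i => x i) (fun i => (x i).2)).symm

theorem ElemSub.refl (M : ZFSet.{u}) : ElemSub M M := ⟨.refl _ _, fun _ => rfl⟩

theorem ElemSub.subset (h : ElemSub M K) : M ⊆ K := by
  obtain ⟨i, hi⟩ := h
  intro x hx
  simpa only [hi] using (i ⟨x, hx⟩).2

theorem ElemSub.realize_iff (h : ElemSub M K) (φ : setLang.Formula α) (v : α → ZFSet.{u})
    (hv : ∀ a, v a ∈ M) : φ.Realize (M := M) (fun a => ⟨v a, hv a⟩) ↔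
      φ.Realize (M := K) (fun a => ⟨v a, h.subset (hv a)⟩) := by
  obtain ⟨i, hi⟩ := id h
  rw [← i.map_formula]
  exact iff_of_eq (congrArg _ (funext fun a => Subtype.ext (hi _)))

theorem ElemSub.realizeIn_iff (h : ElemSub M K) {n : ℕ} (φ : setLang.BoundedFormula Empty n)
    {v : Fin n → ZFSet.{u}} (hv : ∀ i, v i ∈ M) : RealizeIn φ M v ↔ RealizeIn φ K v := by
  obtain ⟨i, hi⟩ := h
  rw [realizeIn_app i φ hv]
  exact iff_of_eq (congrArg _ (funext fun k => (app_of_mem i (hv k)).trans (hi _)))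

theorem UniformlyDefinable.transfer {P : ZFSet.{u} → (α → ZFSet.{u}) → Prop}
    (hP : UniformlyDefinable P) (h : ElemSub M K) (hK : K.IsTransitive) (hN : N.IsTransitive)
    (j : M ↪ₑ[setLang] N) (v : α → ZFSet.{u}) (hv : ∀ a, v a ∈ M) :
    P K v ↔ P N (fun a => app j (v a)) := by
  obtain ⟨φ, hφ⟩ := hP
  rw [← hφ K hK (fun a => ⟨v a, h.subset (hv a)⟩), ← h.realize_iff φ v hv, ← j.map_formula,
    hφ N hN]
  exact iff_of_eq (congrArg _ (funext fun a => (app_of_mem j (hv a)).symm))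

theorem ElemSub.iff_of_isTransitive {P : ZFSet.{u} → (α → ZFSet.{u}) → Prop}
    (hP : UniformlyDefinable P) (h : ElemSub M K) (hK : K.IsTransitive) (hM : M.IsTransitive)
    (v : α → ZFSet.{u}) (hv : ∀ a, v a ∈ M) : P K v ↔ P M v := by
  obtain ⟨φ, hφ⟩ := hP
  rw [← hφ K hK (fun a => ⟨v a, h.subset (hv a)⟩), ← h.realize_iff φ v hv, hφ M hM]

/-- One direction of the Tarski–Vaught criterion. -/
theorem ElemSub.exists_mem {R : ZFSet.{u} → ZFSet.{u} → (α → ZFSet.{u}) → Prop}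
    (h : ElemSub M K) (hK : K.IsTransitive)
    (hR : UniformlyDefinable fun W (v : Option α → ZFSet.{u}) =>
      R (v none) W (fun a => v (some a)))
    (v : α → ZFSet.{u}) (hv : ∀ a, v a ∈ M) (hx : ∃ x ∈ K, R x K v) : ∃ x ∈ M, R x K v := by
  obtain ⟨φ, hφ⟩ := hR
  let ψ := (φ.relabel (fun o : Option α => o.elim (Sum.inr ()) Sum.inl)).iExs Unit
  have realize_ψ : ψ.Realize (M := K) (fun a => ⟨v a, h.subset (hv a)⟩) := by
    obtain ⟨x, hxK, hx⟩ := hx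
    rw [Language.Formula.realize_iExs]
    refine ⟨fun _ => ⟨x, hxK⟩, ?_⟩
    rw [Language.Formula.realize_relabel, hφ K hK]
    exact hx
  rw [← h.realize_iff ψ v hv, Language.Formula.realize_iExs] at realize_ψ
  obtain ⟨i, hi⟩ := realize_ψ
  rw [Language.Formula.realize_relabel] at hi
  refine ⟨i (), (i ()).2, ?_⟩
  have realize_φ := (h.realize_iff φ (fun o : Option α => o.elim (i ()).1 v)
    (by rintro (_ | a); exacts [(i ()).2, hv a])).1 (by
      convert hi using 1; funext o; cases o <;> rfl)
  exact (hφ K hK _).1 realize_φ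

/-- The other direction of the Tarski–Vaught criterion. -/
theorem elemSub_of_realizeIn (hMX : M ⊆ X)
    (h : ∀ (n : ℕ) (φ : setLang.BoundedFormula Empty (n + 1)) (v : Fin n → ZFSet.{u}),
      (∀ i, v i ∈ M) → (∃ x ∈ X, RealizeIn φ X (Fin.snoc v x)) →
        ∃ x ∈ M, RealizeIn φ X (Fin.snoc v x)) : ElemSub M X := by
  let i : M ↪[setLang] X :=
    { toFun := fun x => ⟨x, hMX x.2⟩
      inj' := fun x y e => Subtype.ext (congrArg Subtype.val e :)
      map_fun' := fun f => Empty.elim f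
      map_rel' := fun r _ => by cases r; exact Iff.rfl }
  refine ⟨i.toElementaryEmbedding fun n φ v a ha => ?_, fun x => rfl⟩
  rw [← RamseyLike.realizeIn_iff, coe_snoc] at ha
  obtain ⟨b, hb, hb'⟩ := h n φ (fun k => v k) (fun k => (v k).2) ⟨a, a.2, ha⟩
  refine ⟨⟨b, hb⟩, ?_⟩
  rw [← RamseyLike.realizeIn_iff, coe_snoc]
  exact hb'

theorem ElemSub.inter (h : ElemSub M K) (hK : K.IsTransitive) (hX : X ∈ M) :
    ElemSub (M ∩ X) X := by
  refine elemSub_of_realizeIn (fun x hx => (ZFSet.mem_inter.1 hx).2) fun n φ v hv hx => ?_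
  have : UniformlyDefinable (fun (_ : ZFSet.{u}) (w : Option (Option (Fin n)) → ZFSet.{u}) =>
      RealizeIn φ (w (some none)) (Fin.snoc (fun i => w (some (some i))) (w none))) :=
    .snoc (P := fun _ => RealizeIn φ) inferInstance
  obtain ⟨x, hx, h'⟩ := hx
  obtain ⟨y, hy, hyX, hy'⟩ := h.exists_mem hK
    (R := fun x _ (w : Option (Fin n) → ZFSet.{u}) =>
      x ∈ w none ∧ RealizeIn φ (w none) (Fin.snoc (fun i => w (some i)) x)) inferInstance
    (fun o => o.elim X v)
    (by rintro (_ | i); exacts [hX, (ZFSet.mem_inter.1 (hv i)).1])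
    ⟨x, hK _ (h.subset hX) hx, hx, h'⟩
  exact ⟨y, ZFSet.mem_inter.2 ⟨hy, hyX⟩, hy'⟩

theorem ElemSub.extensional (h : ElemSub M K) (hK : K.IsTransitive) :
    ∀ x ∈ M, ∀ y ∈ M, (∀ z ∈ M, z ∈ x ↔ z ∈ y) → x = y := by
  intro x hx y hy hxy
  by_contra hne
  obtain ⟨z, hz⟩ : ∃ z, ¬ (z ∈ x ↔ z ∈ y) := by
    by_contra! h'
    exact hne (ZFSet.ext h')
  have hzK : z ∈ K := by
    by_contra hzK
    exact hz ⟨fun hzx => (hzK (hK _ (h.subset hx) hzx)).elim,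
      fun hzy => (hzK (hK _ (h.subset hy) hzy)).elim⟩
  obtain ⟨w, hw, h'⟩ := h.exists_mem hK
    (R := fun z _ (v : Fin 2 → ZFSet.{u}) => ¬ (z ∈ v 0 ↔ z ∈ v 1))
    inferInstance ![x, y] (by simp [Fin.forall_fin_succ, hx, hy]) ⟨z, hzK, hz⟩
  exact h' (hxy w hw)

end Elementary

/-! ### Cardinalities -/

theorem card_range_le {x : ZFSet.{u}} (F : x → ZFSet.{u}) : (ZFSet.range F).card ≤ x.card := by
  simpa [ZFSet.cardinalMk_coe_sort] using ZFSet.lift_card_range_le (f := F)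

theorem card_le_of_surj {k t : ZFSet.{u}} (F : ZFSet.{u} → ZFSet.{u})
    (h : ∀ y ∈ t, ∃ a ∈ k, F a = y) : t.card ≤ k.card := by
  refine (ZFSet.card_mono fun y hy => ?_).trans (card_range_le fun a : k => F a)
  obtain ⟨a, ha, e⟩ := h y hy
  exact ZFSet.mem_range.2 ⟨⟨a, ha⟩, e⟩

theorem exists_surj_of_card_le {k t : ZFSet.{u}} (h : t.card ≤ k.card) (ht : t.Nonempty) :
    ∃ F : ZFSet.{u} → ZFSet.{u}, (∀ a ∈ k, F a ∈ t) ∧ ∀ y ∈ t, ∃ a ∈ k, F a = y := by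
  obtain ⟨e⟩ : Cardinal.mk t ≤ Cardinal.mk k := by
    simpa only [ZFSet.cardinalMk_coe_sort, Cardinal.lift_le] using h
  obtain ⟨y₀, hy₀⟩ := ht
  have : Nonempty t := ⟨⟨y₀, hy₀⟩⟩
  classical
  let F : ZFSet.{u} → ZFSet.{u} := fun a =>
    if h : a ∈ k then (Function.invFun e ⟨a, h⟩ : t) else ∅
  have F_eq (a : k) : F a = (Function.invFun e a : t) := dif_pos a.2
  refine ⟨F, fun a ha => ?_, fun y hy => ⟨e ⟨y, hy⟩, (e _).2, ?_⟩⟩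
  · rw [F_eq ⟨a, ha⟩]
    exact (Function.invFun e _).2
  · rw [F_eq, Function.leftInverse_invFun e.injective]

theorem card_insert_lt {θ : Cardinal.{u}} (hθ : Cardinal.aleph0 ≤ θ) {x y : ZFSet.{u}}
    (h : y.card < θ) : (insert x y).card < θ :=
  ZFSet.card_insert_le.trans_lt (Cardinal.add_lt_of_lt hθ h (Cardinal.one_lt_aleph0.trans_le hθ))

theorem card_iUnion_lt {θ : Cardinal.{u}} (hθ : θ.IsRegular) {x : ZFSet.{u}} (hx : x.card < θ)
    (F : ZFSet.{u} → ZFSet.{u}) (h : ∀ y ∈ x, (F y).card < θ) :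
    (ZFSet.iUnion (fun y : x => F y)).card < θ := by
  have sum_lt : Cardinal.sum (fun y : x => (F y).card) < Cardinal.lift.{u + 1} θ := by
    have lift_sum := Cardinal.lift_sum.{u + 1, u, u + 1} fun y : x => (F y).card
    rw [Cardinal.lift_id.{u + 1}] at lift_sum
    rw [lift_sum]
    refine Cardinal.sum_lt_of_isRegular hθ.lift ?_ fun y => Cardinal.lift_lt.2 (h y y.2)
    rw [ZFSet.cardinalMk_coe_sort]
    exact Cardinal.lift_lt.2 hx
  exact Cardinal.lift_lt.1 (ZFSet.lift_card_iUnion_le_sum_card.trans_lt sum_lt)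

theorem isTransitive_insert {x t : ZFSet.{u}} (ht : t.IsTransitive) (hx : x ⊆ t) :
    (insert x t).IsTransitive := by
  intro z hz w hw
  rw [ZFSet.mem_insert_iff] at hz ⊢
  rcases hz with rfl | hz
  · exact Or.inr (hx hw)
  · exact Or.inr (ht _ hz hw)

/-! ### Closure properties of `H(θ)` -/

section H

variable {θ : Cardinal.{u}} {x y : ZFSet.{u}}

theorem isTransitive_H : (H θ).IsTransitive := by
  intro x hx y hy
  obtain ⟨t, ht, hxt, hc⟩ := mem_H.1 hx
  exact mem_H.2 ⟨t, ht, ht _ (hxt hy), hc⟩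

theorem mem_H_of_subset (hy : y ∈ H θ) (h : x ⊆ y) : x ∈ H θ := by
  obtain ⟨t, ht, hyt, hc⟩ := mem_H.1 hy
  exact mem_H.2 ⟨t, ht, h.trans hyt, hc⟩

theorem mem_H_of_card_lt (hθ : θ.IsRegular) (h : x ⊆ H θ) (hc : x.card < θ) : x ∈ H θ := by
  have exists_transitive : ∀ y : ZFSet.{u}, ∃ t : ZFSet.{u}, y ∈ x →
      t.IsTransitive ∧ y ⊆ t ∧ t.card < θ := by
    intro y
    by_cases hy : y ∈ x
    · exact (mem_H.1 (h hy)).imp fun _ ht _ => ht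
    · exact ⟨∅, fun h => (hy h).elim⟩
  choose t ht using exists_transitive
  refine mem_H.2 ⟨ZFSet.iUnion (fun y : x => insert y.1 (t y)), ?_, ?_, ?_⟩
  · exact ZFSet.IsTransitive.iUnion fun y => isTransitive_insert (ht y y.2).1 (ht y y.2).2.1
  · exact fun y hy => ZFSet.mem_iUnion.2 ⟨⟨y, hy⟩, ZFSet.mem_insert _ _⟩
  · exact card_iUnion_lt hθ hc (fun y => insert y (t y))
      fun y hy => card_insert_lt hθ.aleph0_le (ht y hy).2.2

theorem mem_H_of_isTransitive (hx : x.IsTransitive) (hc : x.card < θ) : x ∈ H θ :=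
  mem_H.2 ⟨x, hx, fun _ h => h, hc⟩

theorem empty_mem_H (hθ : θ.IsRegular) : ∅ ∈ H θ :=
  mem_H_of_isTransitive ZFSet.isTransitive_empty (by simpa using hθ.pos)

theorem upair_mem_H (hθ : θ.IsRegular) (hx : x ∈ H θ) (hy : y ∈ H θ) :
    ({x, y} : ZFSet.{u}) ∈ H θ := by
  refine mem_H_of_card_lt hθ (fun z hz => ?_) (card_insert_lt hθ.aleph0_le ?_)
  · rcases ZFSet.mem_pair.1 hz with rfl | rfl <;> assumption
  · rw [ZFSet.card_singleton]
    exact Cardinal.one_lt_aleph0.trans_le hθ.aleph0_le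

theorem pair_mem_H (hθ : θ.IsRegular) (hx : x ∈ H θ) (hy : y ∈ H θ) : ZFSet.pair x y ∈ H θ := by
  have singleton_mem := upair_mem_H hθ hx hx
  rw [ZFSet.pair_eq_singleton] at singleton_mem
  exact upair_mem_H hθ singleton_mem (upair_mem_H hθ hx hy)

theorem sUnion_mem_H (hx : x ∈ H θ) : ZFSet.sUnion x ∈ H θ := by
  obtain ⟨t, ht, hxt, hc⟩ := mem_H.1 hx
  refine mem_H.2 ⟨t, ht, fun z hz => ?_, hc⟩
  obtain ⟨y, hy, hz⟩ := ZFSet.mem_sUnion.1 hz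
  exact ht _ (hxt hy) hz

theorem card_lt_of_mem_H (hx : x ∈ H θ) : x.card < θ := by
  obtain ⟨t, -, hxt, hc⟩ := mem_H.1 hx
  exact (ZFSet.card_mono hxt).trans_lt hc

theorem H_subset_H {θ' : Cardinal.{u}} (h : θ ≤ θ') : H θ ⊆ H θ' := by
  intro x hx
  obtain ⟨t, ht, hxt, hc⟩ := mem_H.1 hx
  exact mem_H.2 ⟨t, ht, hxt, hc.trans_le h⟩

theorem toZFSet_mem_H {o : Ordinal.{u}} (h : o.card < θ) : o.toZFSet ∈ H θ :=
  mem_H_of_isTransitive (ZFSet.isOrdinal_toZFSet o).isTransitive (by rwa [Ordinal.card_toZFSet])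

theorem card_cardSet (κ : Cardinal.{u}) : (cardSet κ).card = κ := by
  rw [cardSet, Ordinal.card_toZFSet, Cardinal.card_ord]

theorem isOrdinal_cardSet (κ : Cardinal.{u}) : (cardSet κ).IsOrdinal :=
  ZFSet.isOrdinal_toZFSet _

theorem cardSet_mem_H {κ : Cardinal.{u}} (h : κ < θ) : cardSet κ ∈ H θ :=
  toZFSet_mem_H (by rwa [Cardinal.card_ord])

end H

/-! ### Functions and enumerations as sets -/

section Function

variable {k t f a y z : ZFSet.{u}} {F : ZFSet.{u} → ZFSet.{u}}

/-- The function `F` restricted to `k`, as a set of ordered pairs. This is `ZFSet.map` without the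
requirement that `F` be definable. -/
noncomputable def graph (k : ZFSet.{u}) (F : ZFSet.{u} → ZFSet.{u}) : ZFSet.{u} :=
  @ZFSet.map F (Classical.allZFSetDefinable _) k

theorem mem_graph {p : ZFSet.{u}} : p ∈ graph k F ↔ ∃ a ∈ k, ZFSet.pair a (F a) = p :=
  @ZFSet.mem_map F (Classical.allZFSetDefinable _) k p

theorem pair_mem_graph : ZFSet.pair a y ∈ graph k F ↔ a ∈ k ∧ y = F a := by
  rw [mem_graph]
  constructor
  · rintro ⟨b, hb, e⟩
    obtain ⟨rfl, rfl⟩ := ZFSet.pair_inj.1 e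
    exact ⟨hb, rfl⟩
  · rintro ⟨h, rfl⟩
    exact ⟨a, h, rfl⟩

theorem isFunc_graph (h : ∀ a ∈ k, F a ∈ t) : ZFSet.IsFunc k t (graph k F) :=
  (@ZFSet.map_isFunc F (Classical.allZFSetDefinable _) k t).2 h

theorem graph_mem_H {θ : Cardinal.{u}} (hθ : θ.IsRegular) (hk : k ∈ H θ)
    (h : ∀ a ∈ k, F a ∈ H θ) : graph k F ∈ H θ := by
  refine mem_H_of_card_lt hθ (fun p hp => ?_)
    ((card_le_of_surj _ fun _ hp => mem_graph.1 hp).trans_lt (card_lt_of_mem_H hk))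
  obtain ⟨a, ha, rfl⟩ := mem_graph.1 hp
  exact pair_mem_H hθ (isTransitive_H _ hk ha) (h a ha)

theorem graph_congr {G : ZFSet.{u} → ZFSet.{u}} (h : ∀ a ∈ k, F a = G a) :
    graph k F = graph k G := by
  ext p
  simp only [mem_graph]
  exact exists_congr fun a => and_congr_right fun ha => by rw [h a ha]

/-- The value of the function `f` at `a`. It is defined as a union in order to be uniformly
definable, and its value is junk if there is no unique `y` with `(a, y) ∈ f`. -/
noncomputable def val (f a : ZFSet.{u}) : ZFSet.{u} :=
  ZFSet.sUnion (ZFSet.sep (fun y => ZFSet.pair a y ∈ f) (ZFSet.sUnion (ZFSet.sUnion f)))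

theorem mem_val : z ∈ val f a ↔ ∃ y, ZFSet.pair a y ∈ f ∧ z ∈ y := by
  rw [val, ZFSet.mem_sUnion]
  refine exists_congr fun y => and_congr_left fun _ => ZFSet.mem_sep.trans ?_
  refine and_iff_right_of_imp fun h => ZFSet.mem_sUnion_of_mem (z := {a, y}) (by simp) ?_
  exact ZFSet.mem_sUnion_of_mem (ZFSet.mem_pair.2 (Or.inr rfl)) h

theorem val_graph (ha : a ∈ k) : val (graph k F) a = F a := by
  ext z
  simp [mem_val, pair_mem_graph, ha]

theorem pair_mem_iff_of_isFunc (hf : ZFSet.IsFunc k t f) (ha : a ∈ k) :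
    ZFSet.pair a y ∈ f ↔ y = val f a := by
  obtain ⟨w, hw, unique⟩ := hf.2 a ha
  have val_eq : val f a = w := by
    ext z
    rw [mem_val]
    refine ⟨?_, fun hz => ⟨w, hw, hz⟩⟩
    rintro ⟨y, hy, hz⟩
    exact unique y hy ▸ hz
  rw [val_eq]
  exact ⟨unique y, fun e => e ▸ hw⟩

theorem mem_of_pair_mem_of_isFunc (hf : ZFSet.IsFunc k t f) (h : ZFSet.pair a y ∈ f) :
    a ∈ k ∧ y ∈ t :=
  ZFSet.pair_mem_prod.1 (hf.1 h)

theorem val_mem (hf : ZFSet.IsFunc k t f) (ha : a ∈ k) : val f a ∈ t :=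
  (mem_of_pair_mem_of_isFunc hf ((pair_mem_iff_of_isFunc hf ha).2 rfl)).2

theorem eq_graph_of_isFunc (hf : ZFSet.IsFunc k t f) : f = graph k (val f) := by
  ext p
  rw [mem_graph]
  constructor
  · intro hp
    obtain ⟨a, ha, y, -, rfl⟩ := ZFSet.mem_prod.1 (hf.1 hp)
    exact ⟨a, ha, by rw [(pair_mem_iff_of_isFunc hf ha).1 hp]⟩
  · rintro ⟨a, ha, rfl⟩
    exact (pair_mem_iff_of_isFunc hf ha).2 rfl

theorem isFunc_mem_H {θ : Cardinal.{u}} (hθ : θ.IsRegular) (hk : k ∈ H θ) (ht : t ⊆ H θ)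
    (hf : ZFSet.IsFunc k t f) : f ∈ H θ := by
  rw [eq_graph_of_isFunc hf]
  exact graph_mem_H hθ hk fun a ha => ht (val_mem hf ha)

theorem isFunc_iff : ZFSet.IsFunc k t f ↔
    (∀ p ∈ f, ∃ x ∈ k, ∃ y ∈ t, p = ZFSet.pair x y) ∧
      ∀ x ∈ k, ∃ y ∈ t, ZFSet.pair x y ∈ f ∧ ∀ z ∈ t, ZFSet.pair x z ∈ f → z = y := by
  constructor
  · intro h
    refine ⟨fun p hp => ZFSet.mem_prod.1 (h.1 hp), fun x hx => ?_⟩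
    obtain ⟨y, hxy, unique⟩ := h.2 x hx
    exact ⟨y, (mem_of_pair_mem_of_isFunc h hxy).2, hxy, fun z _ hz => unique z hz⟩
  · rintro ⟨h, exists_unique⟩
    have subset_prod : f ⊆ ZFSet.prod k t := fun p hp => ZFSet.mem_prod.2 (h p hp)
    refine ⟨subset_prod, fun x hx => ?_⟩
    obtain ⟨y, -, hxy, unique⟩ := exists_unique x hx
    exact ⟨y, hxy, fun z hz => unique z (ZFSet.pair_mem_prod.1 (subset_prod hz)).2 hz⟩

theorem mem_of_pair_mem {W : ZFSet.{u}} (hW : W.IsTransitive) (h : ZFSet.pair a y ∈ W) :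
    a ∈ W ∧ y ∈ W := by
  have upair_mem : {a, y} ∈ W := hW.mem_trans (by simp [ZFSet.pair]) h
  exact ⟨hW.mem_trans (by simp) upair_mem, hW.mem_trans (by simp) upair_mem⟩

theorem mem_of_mem_val {W : ZFSet.{u}} (hW : W.IsTransitive) (hf : f ∈ W) (h : z ∈ val f a) :
    z ∈ W := by
  obtain ⟨y, hy, hz⟩ := mem_val.1 h
  exact hW.mem_trans hz (mem_of_pair_mem hW (hW.mem_trans hy hf)).2

instance UniformlyDefinable.mem_val {α : Type} {a b c : α} :
    UniformlyDefinable (fun (_ : ZFSet.{u}) v => v a ∈ val (v b) (v c)) := by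
  have : UniformlyDefinable (fun (W : ZFSet.{u}) v =>
    ∃ y ∈ W, ZFSet.pair (v c) y ∈ v b ∧ v a ∈ y) := inferInstance
  refine this.congr fun W hW v hv => ?_
  rw [RamseyLike.mem_val]
  exact exists_congr fun y => and_iff_right_of_imp fun h =>
    (mem_of_pair_mem hW (hW.mem_trans h.1 (hv b))).2

instance DefinableTerm.val {α : Type} {a b : α} :
    DefinableTerm (fun v : α → ZFSet.{u} => val (v a) (v b)) := by
  constructor
  have : UniformlyDefinable (fun (W : ZFSet.{u}) (v : Option α → ZFSet.{u}) =>
    ∀ z ∈ W, z ∈ v none ↔ z ∈ RamseyLike.val (v (some a)) (v (some b))) := inferInstance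
  refine this.congr fun W hW v hv => ⟨fun h => ZFSet.ext fun z => ?_, fun h z _ => by rw [h]⟩
  exact ⟨fun hz => (h z (hW.mem_trans hz (hv none))).1 hz,
    fun hz => (h z (mem_of_mem_val hW (hv _) hz)).2 hz⟩

instance UniformlyDefinable.term_mem_val {α : Type} {b c : α} {T : (α → ZFSet.{u}) → ZFSet.{u}}
    [hT : DefinableTerm T] :
    UniformlyDefinable (fun (_ : ZFSet.{u}) v => T v ∈ val (v b) (v c)) := by
  have := hT.definable_graph
  have : UniformlyDefinable (fun W v => ∃ x ∈ W, x = T v ∧ x ∈ val (v b) (v c)) := inferInstance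
  refine this.congr fun W hW v hv => ⟨?_, fun h => ⟨_, mem_of_mem_val hW (hv b) h, rfl, h⟩⟩
  rintro ⟨x, -, rfl, hx⟩
  exact hx

instance UniformlyDefinable.isFunc {α : Type} {a b c : α} :
    UniformlyDefinable (fun (_ : ZFSet.{u}) v => ZFSet.IsFunc (v a) (v b) (v c)) := by
  simp only [isFunc_iff]
  infer_instance

/-- `f` is a function from `k` onto the transitive set `t`. -/
def Enumerates (k t f : ZFSet.{u}) : Prop :=
  t.IsTransitive ∧ ZFSet.IsFunc k t f ∧ ∀ y ∈ t, ∃ a ∈ k, ZFSet.pair a y ∈ f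

instance UniformlyDefinable.enumerates {α : Type} {a b c : α} :
    UniformlyDefinable (fun (_ : ZFSet.{u}) v => Enumerates (v a) (v b) (v c)) := by
  unfold Enumerates
  infer_instance

namespace Enumerates

theorem card_le (h : Enumerates k t f) : t.card ≤ k.card := by
  refine card_le_of_surj (val f) fun y hy => ?_
  obtain ⟨a, ha, hay⟩ := h.2.2 y hy
  exact ⟨a, ha, ((pair_mem_iff_of_isFunc h.2.1 ha).1 hay).symm⟩

theorem mem_H_left {θ : Cardinal.{u}} (h : Enumerates k t f) (hk : k ∈ H θ) : t ∈ H θ :=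
  mem_H_of_isTransitive h.1 (h.card_le.trans_lt (card_lt_of_mem_H hk))

theorem mem_H_right {θ : Cardinal.{u}} (h : Enumerates k t f) (hθ : θ.IsRegular) (hk : k ∈ H θ) :
    f ∈ H θ :=
  isFunc_mem_H hθ hk (isTransitive_H _ (h.mem_H_left hk)) h.2.1

end Enumerates

theorem exists_enumerates (ht : t.IsTransitive) (hc : t.card ≤ k.card) (hn : t.Nonempty) :
    ∃ f, Enumerates k t f := by
  obtain ⟨F, mapsTo, surj⟩ := exists_surj_of_card_le hc hn
  refine ⟨graph k F, ht, isFunc_graph mapsTo, fun y hy => ?_⟩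
  obtain ⟨a, ha, rfl⟩ := surj y hy
  exact ⟨a, ha, pair_mem_graph.2 ⟨ha, rfl⟩⟩

theorem mem_H_succ_iff {ν : Cardinal.{u}} (hν : Cardinal.aleph0 ≤ ν) {x : ZFSet.{u}} :
    x ∈ H (Order.succ ν) ↔ ∃ t f, Enumerates (cardSet ν) t f ∧ x ∈ t := by
  constructor
  · intro hx
    obtain ⟨t, ht, hxt, hc⟩ := mem_H.1 hx
    have card_le : (insert x t).card ≤ (cardSet ν).card := by
      rw [card_cardSet]
      exact Order.lt_succ_iff.1 (card_insert_lt (hν.trans (Order.le_succ ν)) hc)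
    obtain ⟨f, hf⟩ :=
      exists_enumerates (isTransitive_insert ht hxt) card_le (ZFSet.insert_nonempty x t)
    exact ⟨_, f, hf, ZFSet.mem_insert _ _⟩
  · rintro ⟨t, f, h, hx⟩
    exact isTransitive_H _ (h.mem_H_left (cardSet_mem_H (Order.lt_succ ν))) hx

end Function

/-! ### Satisfaction relations -/

/-- Codes of operations on unary relations, which suffice to express the formulas of the language
of set theory, see `OpSem` for the meaning of the operations. -/
inductive Code : Type
  | fls : Code
  | node : Fin 6 → Code → Code → Code
  deriving Countable

/-- Distinct hereditarily finite sets. -/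
def tag : ℕ → ZFSet.{u}
  | 0 => ∅
  | n + 1 => ZFSet.pair ∅ (tag n)

theorem pair_ne_empty (x y : ZFSet.{u}) : ZFSet.pair x y ≠ ∅ := by
  intro h
  have singleton_mem : ({x} : ZFSet.{u}) ∈ ZFSet.pair x y := by simp [ZFSet.pair]
  exact ZFSet.notMem_empty _ (h ▸ singleton_mem)

theorem tag_injective : Function.Injective tag.{u} := by
  intro m
  induction m with
  | zero =>
    rintro (_ | n) h
    · rfl
    · exact (pair_ne_empty _ _ h.symm).elim
  | succ m ih =>
    rintro (_ | n) h
    · exact (pair_ne_empty _ _ h).elim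
    · rw [ih (ZFSet.pair_inj.1 h).2]

instance DefinableTerm.tag {α : Type} (n : ℕ) :
    DefinableTerm (fun _ : α → ZFSet.{u} => RamseyLike.tag n) := by
  induction n with
  | zero => exact DefinableTerm.empty
  | succ n ih => exact DefinableTerm.pair

/-- The hereditarily finite set that represents a code. -/
def Code.toZFSet : Code → ZFSet.{u}
  | fls => ∅
  | node o c d => ZFSet.pair (tag o) (ZFSet.pair c.toZFSet d.toZFSet)

theorem Code.toZFSet_injective : Function.Injective Code.toZFSet.{u} := by
  intro c
  induction c with
  | fls =>
    rintro (_ | ⟨o, c, d⟩) h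
    · rfl
    · exact (pair_ne_empty _ _ h.symm).elim
  | node o c d hc hd =>
    rintro (_ | ⟨o', c', d'⟩) h
    · exact (pair_ne_empty _ _ h).elim
    · obtain ⟨tag_eq, args_eq⟩ := ZFSet.pair_inj.1 h
      obtain ⟨left_eq, right_eq⟩ := ZFSet.pair_inj.1 args_eq
      rw [hc left_eq, hd right_eq, Fin.ext (tag_injective tag_eq)]

/-- The operations on unary relations on `X`. Finite sequences of elements of `X` are nested pairs.
The operations `0` and `1` serve to access the entries of a sequence, the others stand for
membership, equality, implication and universal quantification. -/
def OpSem (o : Fin 6) (X : ZFSet.{u}) (P Q : ZFSet.{u} → Prop) (t : ZFSet.{u}) : Prop :=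
  match o with
  | 0 => ∃ s ∈ X, ∃ x ∈ X, t = ZFSet.pair (ZFSet.pair s x) x
  | 1 => ∃ s ∈ X, ∃ x ∈ X, ∃ y ∈ X, t = ZFSet.pair (ZFSet.pair s x) y ∧
      ∃ w ∈ X, w = ZFSet.pair s y ∧ P w
  | 2 => ∃ y ∈ X, ∃ z ∈ X, (∃ w ∈ X, w = ZFSet.pair t y ∧ P w) ∧
      (∃ w ∈ X, w = ZFSet.pair t z ∧ Q w) ∧ y ∈ z
  | 3 => ∃ y ∈ X, ∃ z ∈ X, (∃ w ∈ X, w = ZFSet.pair t y ∧ P w) ∧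
      (∃ w ∈ X, w = ZFSet.pair t z ∧ Q w) ∧ y = z
  | 4 => P t → Q t
  | 5 => ∀ x ∈ X, ∀ w ∈ X, w = ZFSet.pair t x → P w

theorem opSem_congr {o : Fin 6} {X : ZFSet.{u}} {P P' Q Q' : ZFSet.{u} → Prop} {t : ZFSet.{u}}
    (ht : t ∈ X) (hP : ∀ x ∈ X, P x ↔ P' x) (hQ : ∀ x ∈ X, Q x ↔ Q' x) :
    OpSem o X P Q t ↔ OpSem o X P' Q' t := by
  have exists_congr_of {P P' : ZFSet.{u} → Prop} (h : ∀ x ∈ X, P x ↔ P' x) (p : ZFSet.{u}) :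
      (∃ w ∈ X, w = p ∧ P w) ↔ ∃ w ∈ X, w = p ∧ P' w :=
    exists_congr fun w => and_congr_right fun hw => and_congr_right fun _ => h w hw
  fin_cases o
  · exact Iff.rfl
  · simp only [OpSem, exists_congr_of hP]
  · simp only [OpSem, exists_congr_of hP, exists_congr_of hQ]
  · simp only [OpSem, exists_congr_of hP, exists_congr_of hQ]
  · exact imp_congr (hP t ht) (hQ t ht)
  · exact forall₂_congr fun x _ => forall₂_congr fun w h => imp_congr_right fun _ => hP w h

namespace UniformlyDefinable

variable {α : Type} {P Q : ZFSet.{u} → ZFSet.{u} → (α → ZFSet.{u}) → Prop}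

theorem weaken {β : Type} (f : α → β)
    (hP : UniformlyDefinable fun W (v : Option α → ZFSet.{u}) =>
      P (v none) W (fun a => v (some a))) :
    UniformlyDefinable fun W (v : Option β → ZFSet.{u}) =>
      P (v none) W (fun a => v (some (f a))) :=
  hP.comap (Option.map f)

theorem eval (a : α)
    (hP : UniformlyDefinable fun W (v : Option α → ZFSet.{u}) =>
      P (v none) W (fun a => v (some a))) :
    UniformlyDefinable fun W v => P (v a) W v :=
  hP.comap (fun o : Option α => o.elim a id)

variable [hP : UniformlyDefinable fun W (v : Option α → ZFSet.{u}) =>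
    P (v none) W (fun a => v (some a))]
  [hQ : UniformlyDefinable fun W (v : Option α → ZFSet.{u}) =>
    Q (v none) W (fun a => v (some a))]
include hP hQ

theorem opSem_of_eq_or {X : ZFSet.{u} → (α → ZFSet.{u}) → ZFSet.{u}}
    (hX : (X = fun W _ => W) ∨ ∃ a, X = fun _ v => v a) (o : Fin 6) (b : α) :
    UniformlyDefinable fun W v => OpSem o (X W v) (fun x => P x W v) (fun x => Q x W v) (v b) := by
  have P₁ := hP.weaken (some : α → Option α)
  have P₂ := hP.weaken (fun a => some (some a) : α → Option (Option α))
  have P₃ := hP.weaken (fun a => some (some (some a)) : α → Option (Option (Option α)))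
  have Q₂ := hQ.weaken (fun a => some (some a) : α → Option (Option α))
  have P₀ (a : α) := hP.eval a
  have Q₀ (a : α) := hQ.eval a
  rcases hX with rfl | ⟨a, rfl⟩ <;> fin_cases o <;> simp only [OpSem] <;> infer_instance

instance opSem {o : Fin 6} {a b : α} :
    UniformlyDefinable (fun W v => OpSem o (v a) (fun x => P x W v) (fun x => Q x W v) (v b)) :=
  opSem_of_eq_or (Or.inr ⟨a, rfl⟩) o b

instance opSem_ambient {o : Fin 6} {b : α} :
    UniformlyDefinable (fun W v => OpSem o W (fun x => P x W v) (fun x => Q x W v) (v b)) :=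
  opSem_of_eq_or (Or.inl rfl) o b

end UniformlyDefinable

/-- The unary relation on `X` with the given code. -/
def sat (X : ZFSet.{u}) : Code → ZFSet.{u} → Prop
  | .fls => fun _ => False
  | .node o c d => OpSem o X (sat X c) (sat X d)

instance UniformlyDefinable.sat {c : Code} {α : Type} {b : α} :
    UniformlyDefinable (fun (W : ZFSet.{u}) v => sat W c (v b)) := by
  induction c generalizing α with
  | fls => exact UniformlyDefinable.false
  | node o c d hc hd =>
    exact inferInstanceAs (UniformlyDefinable fun W v =>
      OpSem o W (fun x => RamseyLike.sat W c x) (fun x => RamseyLike.sat W d x) (v b))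

/-- The set `F` contains the codes. -/
def ClosedCodes (F : ZFSet.{u}) : Prop :=
  ∅ ∈ F ∧ ∀ o : Fin 6, ∀ c ∈ F, ∀ d ∈ F, ZFSet.pair (tag o) (ZFSet.pair c d) ∈ F

/-- The set `D` is a satisfaction relation for `X`: it satisfies the recursion that defines `sat`
on the codes in `F`. -/
def IsSat (F D X : ZFSet.{u}) : Prop :=
  (∀ t ∈ X, ZFSet.pair ∅ t ∉ D) ∧ ∀ o : Fin 6, ∀ c ∈ F, ∀ d ∈ F, ∀ t ∈ X,
    ZFSet.pair (ZFSet.pair (tag o) (ZFSet.pair c d)) t ∈ D ↔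
      OpSem o X (fun x => ZFSet.pair c x ∈ D) (fun x => ZFSet.pair d x ∈ D) t

instance UniformlyDefinable.closedCodes {α : Type} {a : α} :
    UniformlyDefinable (fun (_ : ZFSet.{u}) v => ClosedCodes (v a)) := by
  unfold ClosedCodes
  infer_instance

instance UniformlyDefinable.isSat {α : Type} {a b c : α} :
    UniformlyDefinable (fun (_ : ZFSet.{u}) v => IsSat (v a) (v b) (v c)) := by
  unfold IsSat
  infer_instance

theorem ClosedCodes.toZFSet_mem {F : ZFSet.{u}} (h : ClosedCodes F) (c : Code) : c.toZFSet ∈ F := by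
  induction c with
  | fls => exact h.1
  | node o c d hc hd => exact h.2 o _ hc _ hd

theorem IsSat.iff {F D X : ZFSet.{u}} (h : IsSat F D X) (hF : ClosedCodes F) (c : Code) :
    ∀ t ∈ X, ZFSet.pair c.toZFSet t ∈ D ↔ sat X c t := by
  induction c with
  | fls => exact fun t ht => ⟨h.1 t ht, False.elim⟩
  | node o c d hc hd =>
    intro t ht
    exact (h.2 o _ (hF.toZFSet_mem c) _ (hF.toZFSet_mem d) t ht).trans (opSem_congr ht hc hd)

/-- The set of codes. -/
noncomputable def codes : ZFSet.{u} := ZFSet.range (Code.toZFSet.{u})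

theorem mem_codes {x : ZFSet.{u}} : x ∈ codes ↔ ∃ c : Code, c.toZFSet = x := ZFSet.mem_range

theorem closedCodes_codes : ClosedCodes codes.{u} := by
  refine ⟨mem_codes.2 ⟨.fls, rfl⟩, fun o c hc d hd => ?_⟩
  obtain ⟨c, rfl⟩ := mem_codes.1 hc
  obtain ⟨d, rfl⟩ := mem_codes.1 hd
  exact mem_codes.2 ⟨.node o c d, rfl⟩

theorem ClosedCodes.codes_subset {F : ZFSet.{u}} (h : ClosedCodes F) : codes ⊆ F := by
  intro x hx
  obtain ⟨c, rfl⟩ := mem_codes.1 hx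
  exact h.toZFSet_mem c

theorem card_codes_le : codes.{u}.card ≤ Cardinal.aleph0 := by
  have lift_card_le := ZFSet.lift_card_range_le (f := Code.toZFSet.{u}) |>.trans
    (Cardinal.lift_le.2 (Cardinal.mk_le_aleph0 (α := Code)))
  rwa [Cardinal.lift_aleph0, Cardinal.lift_le_aleph0] at lift_card_le

/-- The satisfaction relation for `X`. -/
noncomputable def satSet (X : ZFSet.{u}) : ZFSet.{u} :=
  ZFSet.sep (fun p => ∃ c t, p = ZFSet.pair (Code.toZFSet c) t ∧ sat X c t) (ZFSet.prod codes X)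

theorem pair_mem_satSet {X t : ZFSet.{u}} {c : Code} :
    ZFSet.pair c.toZFSet t ∈ satSet X ↔ t ∈ X ∧ sat X c t := by
  rw [satSet, ZFSet.mem_sep, ZFSet.pair_mem_prod]
  constructor
  · rintro ⟨⟨-, ht⟩, c', t', h, h_sat⟩
    obtain ⟨e, rfl⟩ := ZFSet.pair_inj.1 h
    rw [Code.toZFSet_injective e]
    exact ⟨ht, h_sat⟩
  · rintro ⟨ht, h_sat⟩
    exact ⟨⟨mem_codes.2 ⟨c, rfl⟩, ht⟩, c, t, rfl, h_sat⟩

theorem isSat_satSet (X : ZFSet.{u}) : IsSat codes (satSet X) X := by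
  refine ⟨fun t _ h => (pair_mem_satSet (c := .fls)).1 h |>.2, fun o c hc d hd t ht => ?_⟩
  obtain ⟨c, rfl⟩ := mem_codes.1 hc
  obtain ⟨d, rfl⟩ := mem_codes.1 hd
  refine (pair_mem_satSet (c := .node o c d)).trans ((and_iff_right ht).trans ?_)
  exact opSem_congr ht (fun x hx => (pair_mem_satSet.trans (and_iff_right hx)).symm)
    (fun x hx => (pair_mem_satSet.trans (and_iff_right hx)).symm)

section H

variable {θ : Cardinal.{u}}

theorem tag_mem_H (hθ : θ.IsRegular) (n : ℕ) : tag n ∈ H θ := by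
  induction n with
  | zero => exact empty_mem_H hθ
  | succ n ih => exact pair_mem_H hθ (empty_mem_H hθ) ih

theorem Code.toZFSet_mem_H (hθ : θ.IsRegular) (c : Code) : c.toZFSet ∈ H θ := by
  induction c with
  | fls => exact empty_mem_H hθ
  | node o c d hc hd => exact pair_mem_H hθ (tag_mem_H hθ _) (pair_mem_H hθ hc hd)

theorem codes_mem_H (hθ : θ.IsRegular) (h : Cardinal.aleph0 < θ) : codes ∈ H θ := by
  refine mem_H_of_card_lt hθ (fun x hx => ?_) (card_codes_le.trans_lt h)
  obtain ⟨c, rfl⟩ := mem_codes.1 hx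
  exact c.toZFSet_mem_H hθ

theorem prod_mem_H (hθ : θ.IsRegular) {x y : ZFSet.{u}} (hx : x ∈ H θ) (hy : y ∈ H θ) :
    ZFSet.prod x y ∈ H θ := by
  refine mem_H_of_card_lt hθ (fun p hp => ?_) ?_
  · obtain ⟨a, ha, b, hb, rfl⟩ := ZFSet.mem_prod.1 hp
    exact pair_mem_H hθ (isTransitive_H _ hx ha) (isTransitive_H _ hy hb)
  · refine (ZFSet.card_mono fun p hp => ?_).trans_lt (card_iUnion_lt hθ (card_lt_of_mem_H hx)
      (fun a => ZFSet.range (fun b : y => ZFSet.pair a b))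
      fun a _ => (card_range_le _).trans_lt (card_lt_of_mem_H hy))
    obtain ⟨a, ha, b, hb, rfl⟩ := ZFSet.mem_prod.1 hp
    exact ZFSet.mem_iUnion.2 ⟨⟨a, ha⟩, ZFSet.mem_range.2 ⟨⟨b, hb⟩, rfl⟩⟩

theorem satSet_mem_H (hθ : θ.IsRegular) (h : Cardinal.aleph0 < θ) {X : ZFSet.{u}} (hX : X ∈ H θ) :
    satSet X ∈ H θ :=
  mem_H_of_subset (prod_mem_H hθ (codes_mem_H hθ h) hX) ZFSet.sep_subset

end H

/-! ### Formulas as codes -/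

/-- `X` contains the empty set and is closed under ordered pairs. -/
def PairClosed (X : ZFSet.{u}) : Prop :=
  ∅ ∈ X ∧ ∀ x ∈ X, ∀ y ∈ X, ZFSet.pair x y ∈ X

instance UniformlyDefinable.pairClosed {α : Type} {a : α} :
    UniformlyDefinable (fun (_ : ZFSet.{u}) v => PairClosed (v a)) := by
  unfold PairClosed
  infer_instance

theorem pairClosed_H {θ : Cardinal.{u}} (hθ : θ.IsRegular) : PairClosed (H θ) :=
  ⟨empty_mem_H hθ, fun _ hx _ hy => pair_mem_H hθ hx hy⟩

/-- The finite sequence `v` as a nested pair. -/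
def tuple : (n : ℕ) → (Fin n → ZFSet.{u}) → ZFSet.{u}
  | 0, _ => ∅
  | n + 1, v => ZFSet.pair (tuple n (Fin.init v)) (v (Fin.last n))

theorem tuple_snoc {n : ℕ} (v : Fin n → ZFSet.{u}) (x : ZFSet.{u}) :
    tuple (n + 1) (Fin.snoc v x) = ZFSet.pair (tuple n v) x := by
  rw [tuple, Fin.init_snoc, Fin.snoc_last]

theorem PairClosed.tuple_mem {X : ZFSet.{u}} (hX : PairClosed X) :
    ∀ {n : ℕ} {v : Fin n → ZFSet.{u}}, (∀ i, v i ∈ X) → tuple n v ∈ X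
  | 0, _, _ => hX.1
  | _ + 1, _, h => hX.2 _ (hX.tuple_mem fun i => h i.castSucc) _ (h _)

namespace Code

/-- The code of the relation between a sequence and its `k`-th last entry. -/
def proj : ℕ → Code
  | 0 => .node 0 .fls .fls
  | k + 1 => .node 1 (proj k) .fls

variable {X : ZFSet.{u}}

theorem sat_proj_zero {s x y : ZFSet.{u}} (hs : s ∈ X) (hx : x ∈ X) :
    sat X (proj 0) (ZFSet.pair (ZFSet.pair s x) y) ↔ y = x := by
  change (∃ s' ∈ X, ∃ x' ∈ X, ZFSet.pair (ZFSet.pair s x) y = ZFSet.pair (ZFSet.pair s' x') x') ↔ _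
  simp only [ZFSet.pair_inj]
  grind

theorem sat_proj_succ (hX : PairClosed X) (k : ℕ) {s x y : ZFSet.{u}} (hs : s ∈ X) (hx : x ∈ X)
    (hy : y ∈ X) :
    sat X (proj (k + 1)) (ZFSet.pair (ZFSet.pair s x) y) ↔ sat X (proj k) (ZFSet.pair s y) := by
  change (∃ s' ∈ X, ∃ x' ∈ X, ∃ y' ∈ X,
    ZFSet.pair (ZFSet.pair s x) y = ZFSet.pair (ZFSet.pair s' x') y' ∧
      ∃ w ∈ X, w = ZFSet.pair s' y' ∧ sat X (proj k) w) ↔ _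
  simp only [ZFSet.pair_inj]
  grind [hX.2 s hs y hy]

theorem sat_proj (hX : PairClosed X) {n : ℕ} {v : Fin n → ZFSet.{u}} (hv : ∀ i, v i ∈ X)
    (i : Fin n) {y : ZFSet.{u}} (hy : y ∈ X) :
    sat X (proj (Fin.rev i)) (ZFSet.pair (tuple n v) y) ↔ y = v i := by
  induction n with
  | zero => exact i.elim0
  | succ n ih =>
    have init_mem := hX.tuple_mem fun i => hv i.castSucc
    cases i using Fin.lastCases with
    | last =>
      rw [Fin.rev_last]
      exact sat_proj_zero init_mem (hv _)
    | cast i =>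
      rw [Fin.rev_castSucc]
      exact (sat_proj_succ hX _ init_mem (hv _) hy).trans (ih (fun i => hv i.castSucc) i)

theorem exists_sat_proj_iff (hX : PairClosed X) {n : ℕ} {v : Fin n → ZFSet.{u}}
    (hv : ∀ i, v i ∈ X) (i k : Fin n) (R : ZFSet.{u} → ZFSet.{u} → Prop) :
    (∃ y ∈ X, ∃ z ∈ X, (∃ w ∈ X, w = ZFSet.pair (tuple n v) y ∧ sat X (proj (Fin.rev i)) w) ∧
      (∃ w ∈ X, w = ZFSet.pair (tuple n v) z ∧ sat X (proj (Fin.rev k)) w) ∧ R y z) ↔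
        R (v i) (v k) := by
  have entry_iff (i : Fin n) {y : ZFSet.{u}} (hy : y ∈ X) :
      (∃ w ∈ X, w = ZFSet.pair (tuple n v) y ∧ sat X (proj (Fin.rev i)) w) ↔ y = v i := by
    rw [← sat_proj hX hv i hy]
    exact ⟨by rintro ⟨_, -, rfl, h⟩; exact h, fun h => ⟨_, hX.2 _ (hX.tuple_mem hv) _ hy, rfl, h⟩⟩
  constructor
  · rintro ⟨y, hy, z, hz, h, h', hR⟩
    rwa [← (entry_iff i hy).1 h, ← (entry_iff k hz).1 h']
  · exact fun hR =>
      ⟨_, hv i, _, hv k, (entry_iff i (hv i)).2 rfl, (entry_iff k (hv k)).2 rfl, hR⟩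

/-- The code `c` stands for the formula `φ`, in all structures that are closed under pairs. -/
def Represents (c : Code) {n : ℕ} (φ : setLang.BoundedFormula Empty n) : Prop :=
  ∀ X : ZFSet.{u}, PairClosed X → ∀ v : Fin n → ZFSet.{u}, (∀ i, v i ∈ X) →
    (sat X c (tuple n v) ↔ RealizeIn φ X v)

theorem Represents.all {c : Code} {n : ℕ} {φ : setLang.BoundedFormula Empty (n + 1)}
    (h : Represents.{u} c φ) : Represents.{u} (.node 5 c .fls) (.all φ) := by
  intro X hX v hv
  rw [realizeIn_all, and_iff_right hv]
  change (∀ x ∈ X, ∀ w ∈ X, w = ZFSet.pair (tuple n v) x → sat X c w) ↔ _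
  refine forall₂_congr fun x hx => ?_
  rw [← h X hX _ (snoc_mem hv hx), tuple_snoc]
  exact ⟨fun h => h _ (hX.2 _ (hX.tuple_mem hv) _ hx) rfl, fun h w _ e => e ▸ h⟩

theorem exists_represents {n : ℕ} (φ : setLang.BoundedFormula Empty n) :
    ∃ c : Code, Represents.{u} c φ := by
  induction n, φ using setLang_induction with
  | falsum n => exact ⟨.fls, fun X _ v _ => ⟨False.elim, realizeIn_falsum⟩⟩
  | equal n i k =>
    refine ⟨.node 3 (proj (Fin.rev i)) (proj (Fin.rev k)), fun X hX v hv => ?_⟩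
    rw [realizeIn_equal, and_iff_right hv]
    exact exists_sat_proj_iff hX hv i k (· = ·)
  | mem n i k ts hi hk =>
    refine ⟨.node 2 (proj (Fin.rev i)) (proj (Fin.rev k)), fun X hX v hv => ?_⟩
    rw [realizeIn_mem i k ts hi hk, and_iff_right hv]
    exact exists_sat_proj_iff hX hv i k (· ∈ ·)
  | imp n φ ψ hφ hψ =>
    obtain ⟨c, hc⟩ := hφ
    obtain ⟨d, hd⟩ := hψ
    refine ⟨.node 4 c d, fun X hX v hv => ?_⟩
    rw [realizeIn_imp, and_iff_right hv]
    exact imp_congr (hc X hX v hv) (hd X hX v hv)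
  | all n φ h =>
    obtain ⟨c, hc⟩ := h
    exact ⟨_, hc.all⟩

end Code

section OfSat

variable {M N X : ZFSet.{u}}

theorem exists_elementaryEmbedding_of_sat (hM : PairClosed M) (hN : PairClosed N)
    (F : ZFSet.{u} → ZFSet.{u}) (hF : ∀ x ∈ M, F x ∈ N) (map_empty : F ∅ = ∅)
    (map_pair : ∀ x ∈ M, ∀ y ∈ M, F (ZFSet.pair x y) = ZFSet.pair (F x) (F y))
    (h : ∀ (c : Code), ∀ t ∈ M, sat M c t ↔ sat N c (F t)) :
    ∃ j : M ↪ₑ[setLang] N, ∀ x : M, (j x : ZFSet.{u}) = F x := by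
  refine exists_elementaryEmbedding F hF fun n φ v hv => ?_
  have map_tuple {n : ℕ} {v : Fin n → ZFSet.{u}} (hv : ∀ i, v i ∈ M) :
      F (tuple n v) = tuple n (fun i => F (v i)) := by
    induction n with
    | zero => exact map_empty
    | succ n ih =>
      have init_mem := hM.tuple_mem fun i : Fin n => hv i.castSucc
      exact (map_pair _ init_mem _ (hv _)).trans
        (congrArg (ZFSet.pair · _) (ih fun i => hv i.castSucc))
  obtain ⟨c, hc⟩ := Code.exists_represents.{u} φ
  rw [← hc M hM v hv, h c _ (hM.tuple_mem hv), map_tuple hv, hc N hN _ fun i => hF _ (hv i)]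

theorem elemSub_of_sat (hMX : M ⊆ X) (hM : PairClosed M) (hX : PairClosed X)
    (h : ∀ c : Code, ∀ t ∈ M, (∃ x ∈ X, sat X c (ZFSet.pair t x)) →
      ∃ x ∈ M, sat X c (ZFSet.pair t x)) : ElemSub M X := by
  refine elemSub_of_realizeIn hMX fun n φ v hv ⟨x, hx, h_sat⟩ => ?_
  obtain ⟨c, hc⟩ := Code.exists_represents.{u} φ
  have sat_iff : ∀ x ∈ X, sat X c (ZFSet.pair (tuple n v) x) ↔ RealizeIn φ X (Fin.snoc v x) := by
    intro x hx
    rw [← tuple_snoc]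
    exact hc X hX _ (snoc_mem (fun i => hMX (hv i)) hx)
  obtain ⟨y, hy, h_sat'⟩ := h c _ (hM.tuple_mem hv) ⟨x, hx, (sat_iff x hx).2 h_sat⟩
  exact ⟨y, hy, (sat_iff y (hMX hy)).1 h_sat'⟩

end OfSat

section Enumerates

variable {M K ν x t f : ZFSet.{u}}

theorem ElemSub.exists_enumerates (h : ElemSub M K) (hK : K.IsTransitive) (hνM : ν ∈ M)
    (hx : x ∈ M) (ht : t ∈ K) (hf : f ∈ K) (he : Enumerates ν t f) (hxt : x ∈ t) :
    ∃ t ∈ M, ∃ f ∈ M, Enumerates ν t f ∧ x ∈ t := by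
  obtain ⟨t, htM, f, hf, he, hxt⟩ := h.exists_mem hK
    (R := fun t W (v : Fin 2 → ZFSet.{u}) => ∃ f ∈ W, Enumerates (v 0) t f ∧ v 1 ∈ t)
    inferInstance ![ν, x] (by simp [Fin.forall_fin_succ, hνM, hx]) ⟨t, ht, f, hf, he, hxt⟩
  obtain ⟨f, hfM, he⟩ := h.exists_mem hK
    (R := fun f _ (v : Fin 2 → ZFSet.{u}) => Enumerates (v 0) (v 1) f)
    inferInstance ![ν, t] (by simp [Fin.forall_fin_succ, hνM, htM]) ⟨f, hf, he⟩
  exact ⟨t, htM, f, hfM, he, hxt⟩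

theorem ElemSub.enumerates_subset (h : ElemSub M K) (hK : K.IsTransitive) (hν : ν ⊆ M)
    (ht : t ∈ M) (hf : f ∈ M) (he : Enumerates ν t f) : t ⊆ M := by
  intro y hy
  obtain ⟨a, ha, hay⟩ := he.2.2 y hy
  obtain ⟨z, hz, haz⟩ := h.exists_mem hK
    (R := fun y _ (v : Fin 2 → ZFSet.{u}) => ZFSet.pair (v 1) y ∈ v 0)
    inferInstance ![f, a] (by simp [Fin.forall_fin_succ, hf, hν ha])
    ⟨y, hK _ (h.subset ht) hy, hay⟩
  have y_eq : y = z := ((pair_mem_iff_of_isFunc he.2.1 ha).1 hay).trans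
    ((pair_mem_iff_of_isFunc he.2.1 ha).1 haz).symm
  exact y_eq ▸ hz

theorem ElemSub.subset_of_enumerates (h : ElemSub M K) (hK : K.IsTransitive) (hνM : ν ∈ M)
    (hν : ν ⊆ M) (hx : x ∈ M) (ht : t ∈ K) (hf : f ∈ K) (he : Enumerates ν t f) (hxt : x ∈ t) :
    x ⊆ M := by
  obtain ⟨t, ht, f, hf, he, hxt⟩ := h.exists_enumerates hK hνM hx ht hf he hxt
  exact (he.1 _ hxt).trans (h.enumerates_subset hK hν ht hf he)

theorem ElemSub.isTransitive {κ : Cardinal.{u}} (hκ : Cardinal.aleph0 ≤ κ)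
    (h : ElemSub M (H (Order.succ κ))) (hκM : cardSet κ ∈ M) (hκ' : cardSet κ ⊆ M) :
    M.IsTransitive := by
  intro x hx
  obtain ⟨t, f, he, hxt⟩ := (mem_H_succ_iff hκ).1 (h.subset hx)
  have hk := cardSet_mem_H (Order.lt_succ κ)
  exact h.subset_of_enumerates isTransitive_H hκM hκ' hx (he.mem_H_left hk)
    (he.mem_H_right (Cardinal.isRegular_succ hκ) hk) he hxt

end Enumerates

/-! ### Elementary substructures of `H(θ)` satisfy `ZFC⁻` -/

section Interpretation

variable {M : ZFSet.{u}} {n : ℕ}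

theorem isUPair_iff (hM : M.IsTransitive) (d x y : M) :
    IsUPair d x y ↔ d.1 = {x.1, y.1} := by
  constructor
  · intro h
    ext z
    rw [ZFSet.mem_pair]
    constructor
    · intro hz
      exact ((h ⟨z, hM _ d.2 hz⟩).1 hz).imp (congrArg Subtype.val) (congrArg Subtype.val)
    · rintro (rfl | rfl)
      exacts [(h x).2 (Or.inl rfl), (h y).2 (Or.inr rfl)]
  · intro h z
    rw [mem_iff, h, ZFSet.mem_pair, Subtype.ext_iff, Subtype.ext_iff]

theorem rel_iff (hM : M.IsTransitive) (upair_mem : ∀ x ∈ M, ∀ y ∈ M, ({x, y} : ZFSet.{u}) ∈ M)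
    (r x y : M) : Rel r x y ↔ ZFSet.pair x.1 y.1 ∈ r.1 := by
  constructor
  · rintro ⟨p, ⟨s, d, hs, hd, hp⟩, h⟩
    rw [isUPair_iff hM] at hs hd hp
    rw [ZFSet.pair, ← hd, ← ZFSet.pair_eq_singleton, ← hs, ← hp]
    exact h
  · intro h
    refine ⟨⟨_, hM _ r.2 h⟩, ⟨⟨_, upair_mem x x.2 x x.2⟩, ⟨_, upair_mem x x.2 y y.2⟩, ?_, ?_, ?_⟩,
      h⟩
    · rw [isUPair_iff hM]
    · rw [isUPair_iff hM]
    · rw [isUPair_iff hM]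
      simp only [ZFSet.pair, ZFSet.pair_eq_singleton]

theorem realizeIn_relabel_cons {φ : setLang.Formula (Fin (n + 1))} (x : M) (p : Fin n → M) :
    RealizeIn (Language.BoundedFormula.relabel Sum.inr φ) M (Fin.cons x.1 fun i => p i) ↔
      φ.Realize (Fin.cons x p : Fin (n + 1) → M) := by
  rw [← realizeIn_relabel]
  exact iff_of_eq (congrArg _ (Fin.comp_cons Subtype.val x p).symm)

theorem realizeIn_relabel_cons_cons {φ : setLang.Formula (Fin (n + 2))} (x y : M) (p : Fin n → M) :
    RealizeIn (Language.BoundedFormula.relabel Sum.inr φ) M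
        (Fin.cons x.1 (Fin.cons y.1 fun i => p i)) ↔
      φ.Realize (Fin.cons x (Fin.cons y p) : Fin (n + 2) → M) := by
  rw [← realizeIn_relabel_cons]
  exact iff_of_eq (congrArg (fun q => RealizeIn _ M (Fin.cons x.1 q))
    (Fin.comp_cons Subtype.val y p).symm)

theorem cons_mem {x : ZFSet.{u}} (hx : x ∈ M) {p : Fin n → ZFSet.{u}} (hp : ∀ i, p i ∈ M) :
    ∀ i, (Fin.cons x p : Fin (n + 1) → ZFSet.{u}) i ∈ M :=
  Fin.forall_fin_succ.2 ⟨hx, hp⟩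

end Interpretation

namespace UniformlyDefinable

variable {n : ℕ} {α : Type} {a b : α} {f : Fin n → α}

instance realizeIn_cons {φ : setLang.BoundedFormula Empty (n + 1)} :
    UniformlyDefinable fun (W : ZFSet.{u}) v =>
      RealizeIn φ W (Fin.cons (v a) fun i => v (f i)) :=
  (realizeIn_ambient (f := Fin.cons a f)).congr fun W _ v _ =>
    iff_of_eq <| congrArg (RealizeIn φ W) (Fin.comp_cons v a f)

instance realizeIn_cons_cons {φ : setLang.BoundedFormula Empty (n + 2)} :
    UniformlyDefinable fun (W : ZFSet.{u}) v =>
      RealizeIn φ W (Fin.cons (v a) (Fin.cons (v b) fun i => v (f i))) :=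
  (realizeIn_cons (a := a) (f := Fin.cons b f)).congr fun W _ v _ =>
    iff_of_eq <| congrArg (fun q => RealizeIn φ W (Fin.cons (v a) q)) (Fin.comp_cons v b f)

end UniformlyDefinable

/-- The relation `r` is a well-order of `a`, where well-foundedness is tested for the subsets in `W`
only. -/
def WellOrdersIn (W r a : ZFSet.{u}) : Prop :=
  (∀ x ∈ a, ZFSet.pair x x ∉ r) ∧
  (∀ x ∈ a, ∀ y ∈ a, ∀ z ∈ a,
    ZFSet.pair x y ∈ r → ZFSet.pair y z ∈ r → ZFSet.pair x z ∈ r) ∧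
  (∀ x ∈ a, ∀ y ∈ a, ZFSet.pair x y ∈ r ∨ x = y ∨ ZFSet.pair y x ∈ r) ∧
  ∀ b ∈ W, b ⊆ a → (∃ x ∈ b, ¬ False) → ∃ x ∈ b, ∀ y ∈ b, y ≠ x → ZFSet.pair x y ∈ r

instance UniformlyDefinable.wellOrdersIn {α : Type} {a b : α} :
    UniformlyDefinable fun (W : ZFSet.{u}) v => WellOrdersIn W (v a) (v b) := by
  unfold WellOrdersIn
  infer_instance

theorem exists_wellOrdersIn {θ : Cardinal.{u}} (hθ : θ.IsRegular) {a : ZFSet.{u}} (ha : a ∈ H θ) :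
    ∃ r ∈ H θ, WellOrdersIn (H θ) r a := by
  let r := ZFSet.sep (fun p => ∃ x y, p = ZFSet.pair x y ∧ WellOrderingRel x y) (ZFSet.prod a a)
  have pair_mem_r : ∀ x ∈ a, ∀ y ∈ a, ZFSet.pair x y ∈ r ↔ WellOrderingRel x y := by
    intro x hx y hy
    rw [ZFSet.mem_sep, ZFSet.pair_mem_prod]
    constructor
    · rintro ⟨-, x', y', e, hxy⟩
      obtain ⟨rfl, rfl⟩ := ZFSet.pair_inj.1 e
      exact hxy
    · exact fun hxy => ⟨⟨hx, hy⟩, x, y, rfl, hxy⟩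
  refine ⟨r, mem_H_of_subset (prod_mem_H hθ ha ha) ZFSet.sep_subset, ?_, ?_, ?_, ?_⟩
  · exact fun x hx h => irrefl_of WellOrderingRel x ((pair_mem_r x hx x hx).1 h)
  · intro x hx y hy z hz
    rw [pair_mem_r x hx y hy, pair_mem_r y hy z hz, pair_mem_r x hx z hz]
    exact _root_.trans
  · intro x hx y hy
    rw [pair_mem_r x hx y hy, pair_mem_r y hy x hx]
    exact trichotomous_of WellOrderingRel x y
  · rintro b - hb ⟨x, hx, -⟩
    obtain ⟨m, hm, minimal⟩ := (IsWellFounded.wf (r := WellOrderingRel (α := ZFSet.{u}))).has_min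
      (b : Set ZFSet.{u}) ⟨x, hx⟩
    refine ⟨m, hm, fun y hy hne => (pair_mem_r m (hb hm) y (hb hy)).2 ?_⟩
    exact ((trichotomous_of WellOrderingRel m y).resolve_right
      (not_or.2 ⟨hne.symm, minimal y hy⟩))

theorem insert_mem_cardSet_aleph0 {x : ZFSet.{u}} (hx : x ∈ cardSet Cardinal.aleph0.{u}) :
    insert x x ∈ cardSet Cardinal.aleph0.{u} := by
  rw [cardSet, Cardinal.ord_aleph0] at hx ⊢
  obtain ⟨a, ha, rfl⟩ := Ordinal.mem_toZFSet_iff.1 hx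
  rw [← Ordinal.toZFSet_add_one, Ordinal.toZFSet_mem_toZFSet_iff, ← Order.succ_eq_add_one]
  exact Ordinal.isSuccLimit_omega0.succ_lt ha

theorem empty_mem_cardSet {κ : Cardinal.{u}} (hκ : Cardinal.aleph0 ≤ κ) : ∅ ∈ cardSet κ := by
  rw [cardSet, ← Ordinal.toZFSet_zero, Ordinal.toZFSet_mem_toZFSet_iff, Cardinal.lt_ord,
    Ordinal.card_zero]
  exact Cardinal.aleph0_pos.trans_le hκ

namespace ElemSub

variable {θ : Cardinal.{u}} {M x y : ZFSet.{u}}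

theorem upair_mem (h : ElemSub M (H θ)) (hθ : θ.IsRegular) (hx : x ∈ M) (hy : y ∈ M) :
    ({x, y} : ZFSet.{u}) ∈ M := by
  obtain ⟨d, hd, d_subset, hxd, hyd⟩ := h.exists_mem isTransitive_H
    (R := fun d _ (v : Fin 2 → ZFSet.{u}) => (∀ z ∈ d, z = v 0 ∨ z = v 1) ∧ v 0 ∈ d ∧ v 1 ∈ d)
    inferInstance ![x, y] (by simp [Fin.forall_fin_succ, hx, hy])
    ⟨{x, y}, upair_mem_H hθ (h.subset hx) (h.subset hy), by simp⟩
  have d_eq : d = {x, y} := by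
    ext z
    rw [ZFSet.mem_pair]
    exact ⟨d_subset z, fun e => e.elim (fun e => e ▸ hxd) (fun e => e ▸ hyd)⟩
  rwa [← d_eq]

theorem pair_mem (h : ElemSub M (H θ)) (hθ : θ.IsRegular) (hx : x ∈ M) (hy : y ∈ M) :
    ZFSet.pair x y ∈ M := by
  have singleton_mem := h.upair_mem hθ hx hx
  rw [ZFSet.pair_eq_singleton] at singleton_mem
  exact h.upair_mem hθ singleton_mem (h.upair_mem hθ hx hy)

theorem exists_union (h : ElemSub M (H θ)) (hM : M.IsTransitive) (a : M) :
    ∃ b : M, ∀ x, Mem x b ↔ ∃ y, Mem y a ∧ Mem x y := by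
  obtain ⟨b, hb, mem_b_iff⟩ := h.exists_mem isTransitive_H
    (R := fun b W (v : Fin 1 → ZFSet.{u}) => ∀ x ∈ W, x ∈ b ↔ ∃ y ∈ v 0, x ∈ y)
    inferInstance ![a] (by simp)
    ⟨ZFSet.sUnion a, sUnion_mem_H (h.subset a.2), fun x _ => ZFSet.mem_sUnion⟩
  refine ⟨⟨b, hb⟩, fun x => (mem_b_iff x (h.subset x.2)).trans ⟨?_, ?_⟩⟩
  · rintro ⟨y, hy, hxy⟩
    exact ⟨⟨y, hM _ a.2 hy⟩, hy, hxy⟩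
  · rintro ⟨y, hy, hxy⟩
    exact ⟨y, hy, hxy⟩

theorem exists_inductive (h : ElemSub M (H θ)) (hθ : Cardinal.aleph0 < θ) (hM : M.IsTransitive) :
    ∃ w : M, (∃ e, Mem e w ∧ ∀ z, ¬ Mem z e) ∧
      ∀ x, Mem x w → ∃ y, Mem y w ∧ ∀ z, Mem z y ↔ Mem z x ∨ z = x := by
  obtain ⟨w, hw, ⟨e, he, e_empty⟩, exists_succ⟩ := h.exists_mem isTransitive_H
    (R := fun w W (_ : Fin 0 → ZFSet.{u}) => (∃ e ∈ w, ∀ z ∈ e, False) ∧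
      ∀ x ∈ w, ∃ y ∈ w, ∀ z ∈ W, z ∈ y ↔ z ∈ x ∨ z = x)
    inferInstance ![] (by simp)
    ⟨cardSet Cardinal.aleph0, cardSet_mem_H hθ, ⟨∅, empty_mem_cardSet le_rfl, by simp⟩,
      fun x hx => ⟨_, insert_mem_cardSet_aleph0 hx, fun z _ =>
        ZFSet.mem_insert_iff.trans or_comm⟩⟩
  refine ⟨⟨w, hw⟩, ⟨⟨e, hM _ hw he⟩, he, fun z => e_empty z⟩, fun x hx => ?_⟩
  obtain ⟨y, hy, mem_y_iff⟩ := exists_succ x hx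
  refine ⟨⟨y, hM _ hw hy⟩, hy, fun z => (mem_y_iff z (h.subset z.2)).trans ?_⟩
  rw [Subtype.ext_iff]
  rfl

theorem exists_sep (h : ElemSub M (H θ)) {n : ℕ} (φ : setLang.Formula (Fin (n + 1)))
    (p : Fin n → M) (a : M) :
    ∃ b : M, ∀ x, Mem x b ↔ Mem x a ∧ φ.Realize (Fin.cons x p : Fin (n + 1) → M) := by
  let ψ := Language.BoundedFormula.relabel (Sum.inr : _ → Empty ⊕ _) φ
  obtain ⟨b, hb, b_subset, mem_b_iff⟩ := h.exists_mem isTransitive_H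
    (R := fun b W (v : Option (Fin n) → ZFSet.{u}) => b ⊆ v none ∧ ∀ x ∈ v none,
      x ∈ b ↔ RealizeIn ψ W (Fin.cons x fun i => v (some i)))
    inferInstance (fun o => o.elim a fun i => p i)
    (by rintro (_ | i); exacts [a.2, (p i).2])
    ⟨ZFSet.sep (fun x => RealizeIn ψ (H θ) (Fin.cons x fun i => (p i).1)) a,
      mem_H_of_subset (h.subset a.2) ZFSet.sep_subset, ZFSet.sep_subset,
      fun x hx => ZFSet.mem_sep.trans (and_iff_right hx)⟩
  have mem_b_iff_realize (x : M) (hx : x.1 ∈ a.1) :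
      x.1 ∈ b ↔ φ.Realize (Fin.cons x p : Fin (n + 1) → M) := by
    rw [mem_b_iff x.1 hx, ← realizeIn_relabel_cons,
      h.realizeIn_iff _ (cons_mem x.2 fun i => (p i).2)]
    rfl
  exact ⟨⟨b, hb⟩, fun x => ⟨fun hx => ⟨b_subset hx, (mem_b_iff_realize x (b_subset hx)).1 hx⟩,
    fun hx => (mem_b_iff_realize x hx.1).2 hx.2⟩⟩

theorem exists_collection (h : ElemSub M (H θ)) (hθ : θ.IsRegular) (hM : M.IsTransitive) {n : ℕ}
    (φ : setLang.Formula (Fin (n + 2))) (p : Fin n → M) (a : M)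
    (total : ∀ x, Mem x a → ∃ y : M, φ.Realize (Fin.cons x (Fin.cons y p) : Fin (n + 2) → M)) :
    ∃ b : M, ∀ x, Mem x a →
      ∃ y, Mem y b ∧ φ.Realize (Fin.cons x (Fin.cons y p) : Fin (n + 2) → M) := by
  let ψ := Language.BoundedFormula.relabel (Sum.inr : _ → Empty ⊕ _) φ
  have realize_iff (x y : M) : RealizeIn ψ (H θ) (Fin.cons x.1 (Fin.cons y.1 fun i => (p i).1)) ↔
      φ.Realize (Fin.cons x (Fin.cons y p) : Fin (n + 2) → M) := by
    rw [← realizeIn_relabel_cons_cons,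
      h.realizeIn_iff _ (cons_mem x.2 (cons_mem y.2 fun i => (p i).2))]
  choose! F hF using total
  let G : a.1 → ZFSet.{u} := fun x => F ⟨x, hM _ a.2 x.2⟩
  have range_mem : ZFSet.range G ∈ H θ := by
    refine mem_H_of_card_lt hθ (fun y hy => ?_)
      ((card_range_le _).trans_lt (card_lt_of_mem_H (h.subset a.2)))
    obtain ⟨x, rfl⟩ := ZFSet.mem_range.1 hy
    exact h.subset (F _).2
  obtain ⟨b, hb, exists_value⟩ := h.exists_mem isTransitive_H
    (R := fun b W (v : Option (Fin n) → ZFSet.{u}) => ∀ x ∈ v none, ∃ y ∈ b,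
      RealizeIn ψ W (Fin.cons x (Fin.cons y fun i => v (some i))))
    inferInstance (fun o => o.elim a fun i => p i)
    (by rintro (_ | i); exacts [a.2, (p i).2])
    ⟨ZFSet.range G, range_mem, fun x hx => ⟨G ⟨x, hx⟩, ZFSet.mem_range.2 ⟨⟨x, hx⟩, rfl⟩,
      (realize_iff ⟨x, hM _ a.2 hx⟩ _).2 (hF _ hx)⟩⟩
  refine ⟨⟨b, hb⟩, fun x hx => ?_⟩
  obtain ⟨y, hy, hxy⟩ := exists_value x hx
  exact ⟨⟨y, hM _ hb hy⟩, hy, (realize_iff x ⟨y, hM _ hb hy⟩).1 hxy⟩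

theorem exists_wellOrder (h : ElemSub M (H θ)) (hθ : θ.IsRegular) (hM : M.IsTransitive) (a : M) :
    ∃ r : M,
      (∀ x, Mem x a → ¬ Rel r x x) ∧
      (∀ x y z, Mem x a → Mem y a → Mem z a → Rel r x y → Rel r y z → Rel r x z) ∧
      (∀ x y, Mem x a → Mem y a → Rel r x y ∨ x = y ∨ Rel r y x) ∧
      ∀ b : M, (∀ x, Mem x b → Mem x a) → (∃ x, Mem x b) →
        ∃ x, Mem x b ∧ ∀ y, Mem y b → y ≠ x → Rel r x y := by
  obtain ⟨r, hr, irrefl, trans, trichotomous, exists_min⟩ := h.exists_mem isTransitive_H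
    (R := fun r W (v : Fin 1 → ZFSet.{u}) => WellOrdersIn W r (v 0))
    inferInstance ![a] (by simp) (exists_wellOrdersIn hθ (h.subset a.2))
  refine ⟨⟨r, hr⟩, ?_⟩
  simp only [rel_iff hM fun _ hx _ hy => h.upair_mem hθ hx hy]
  refine ⟨fun x hx => irrefl x hx, fun x y z hx hy hz => trans x hx y hy z hz,
    fun x y hx hy => ?_, fun b hb ⟨x, hx⟩ => ?_⟩
  · rw [Subtype.ext_iff]
    exact trichotomous x hx y hy
  · obtain ⟨y, hy, minimal⟩ := exists_min b (h.subset b.2)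
      (fun z hz => hb ⟨z, hM _ b.2 hz⟩ hz) ⟨x, hx, not_false⟩
    exact ⟨⟨y, hM _ b.2 hy⟩, hy, fun z hz hne => minimal z hz fun e => hne (Subtype.ext e)⟩

theorem modelsZFCMinus (h : ElemSub M (H θ)) (hθ : θ.IsRegular) (hθ' : Cardinal.aleph0 < θ)
    (hM : M.IsTransitive) : ModelsZFCMinus M where
  extensionality a b hab := Subtype.ext (ZFSet.ext fun z =>
    ⟨fun hz => (hab ⟨z, hM _ a.2 hz⟩).1 hz, fun hz => (hab ⟨z, hM _ b.2 hz⟩).2 hz⟩)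
  foundation a := by
    rintro ⟨x, hx⟩
    obtain ⟨y, hy, disjoint⟩ := ZFSet.regularity a.1 fun e => ZFSet.notMem_empty x.1 (e ▸ hx)
    refine ⟨⟨y, hM _ a.2 hy⟩, hy, fun z hz hza => ZFSet.notMem_empty z.1 ?_⟩
    exact disjoint ▸ ZFSet.mem_inter.2 ⟨hza, hz⟩
  pairing a b := ⟨⟨_, h.upair_mem hθ a.2 b.2⟩, (isUPair_iff hM _ _ _).2 rfl⟩
  union := h.exists_union hM
  infinity := h.exists_inductive hθ' hM
  separation _ := h.exists_sep
  collection _ := h.exists_collection hθ hM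
  wellOrdering := h.exists_wellOrder hθ hM

end ElemSub

/-! ### Mostowski collapse -/

/-- The Mostowski collapse of the membership relation on `Y`. -/
noncomputable def collapse (Y x : ZFSet.{u}) : ZFSet.{u} :=
  ZFSet.range (fun z : (x ∩ Y : ZFSet.{u}) => collapse Y z)
termination_by x
decreasing_by exact (ZFSet.mem_inter.1 z.2).1

/-- The transitive collapse of `Y`, that is, the image of `Y` under its collapsing map. -/
noncomputable def collapseImage (Y : ZFSet.{u}) : ZFSet.{u} :=
  ZFSet.range (fun z : Y => collapse Y z)

section Collapse

variable {Y x w t : ZFSet.{u}}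

theorem mem_collapse : w ∈ collapse Y x ↔ ∃ z ∈ Y, z ∈ x ∧ collapse Y z = w := by
  rw [collapse, ZFSet.mem_range]
  constructor
  · rintro ⟨⟨z, hz⟩, rfl⟩
    exact ⟨z, (ZFSet.mem_inter.1 hz).2, (ZFSet.mem_inter.1 hz).1, rfl⟩
  · rintro ⟨z, hzY, hzx, rfl⟩
    exact ⟨⟨z, ZFSet.mem_inter.2 ⟨hzx, hzY⟩⟩, rfl⟩

theorem mem_collapseImage : w ∈ collapseImage Y ↔ ∃ z ∈ Y, collapse Y z = w := by
  simp [collapseImage]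

theorem isTransitive_collapseImage : (collapseImage Y).IsTransitive := by
  intro x hx y hy
  obtain ⟨z, -, rfl⟩ := mem_collapseImage.1 hx
  obtain ⟨w, hw, -, rfl⟩ := mem_collapse.1 hy
  exact mem_collapseImage.2 ⟨w, hw, rfl⟩

theorem collapse_injOn (hY : ∀ x ∈ Y, ∀ y ∈ Y, (∀ z ∈ Y, z ∈ x ↔ z ∈ y) → x = y) :
    ∀ x ∈ Y, ∀ y ∈ Y, collapse Y x = collapse Y y → x = y := by
  intro x
  induction x using ZFSet.inductionOn with
  | _ x ih =>
    intro hx y hy h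
    refine hY x hx y hy fun z hz => ⟨fun hzx => ?_, fun hzy => ?_⟩
    · have hmem := mem_collapse.2 ⟨z, hz, hzx, rfl⟩
      rw [h] at hmem
      obtain ⟨z', hz', hzy, e⟩ := mem_collapse.1 hmem
      rwa [ih z hzx hz z' hz' e.symm]
    · have hmem := mem_collapse.2 ⟨z, hz, hzy, rfl⟩
      rw [← h] at hmem
      obtain ⟨z', hz', hzx, e⟩ := mem_collapse.1 hmem
      rwa [← ih z' hzx hz' z hz e]

theorem collapse_eq_self_of_subset (ht : t.IsTransitive) (htY : t ⊆ Y) (hx : x ⊆ t) :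
    collapse Y x = x := by
  induction x using ZFSet.inductionOn with
  | _ x ih =>
    ext w
    rw [mem_collapse]
    constructor
    · rintro ⟨z, -, hzx, rfl⟩
      rwa [ih z hzx (ht _ (hx hzx))]
    · intro hw
      exact ⟨w, htY (hx hw), hw, ih w hw (ht _ (hx hw))⟩

theorem exists_collapse_embedding
    (hY : ∀ x ∈ Y, ∀ y ∈ Y, (∀ z ∈ Y, z ∈ x ↔ z ∈ y) → x = y) :
    ∃ e : Y ↪ₑ[setLang] (collapseImage Y), ∀ x : Y, (e x : ZFSet.{u}) = collapse Y x := by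
  have hinj := collapse_injOn hY
  let f : Y → collapseImage Y := fun x => ⟨collapse Y x, mem_collapseImage.2 ⟨x, x.2, rfl⟩⟩
  have hf : Function.Bijective f := by
    refine ⟨fun x y h => Subtype.ext (hinj x x.2 y y.2 (congrArg Subtype.val h)), fun ⟨w, hw⟩ => ?_⟩
    obtain ⟨z, hz, e⟩ := mem_collapseImage.1 hw
    exact ⟨⟨z, hz⟩, Subtype.ext e⟩
  let e : Y ≃[setLang] (collapseImage Y) :=
    { Equiv.ofBijective f hf with
      map_fun' := fun g => Empty.elim g
      map_rel' := fun r v => by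
        cases r
        change collapse Y (v 0) ∈ collapse Y (v 1) ↔ (v 0).1 ∈ (v 1).1
        rw [mem_collapse]
        constructor
        · rintro ⟨z, hz, hz', h⟩
          rwa [← hinj z hz _ (v 0).2 h]
        · exact fun h => ⟨_, (v 0).2, h, rfl⟩ }
  exact ⟨e.toElementaryEmbedding, fun _ => rfl⟩

end Collapse

/-! ### Embeddings with small target -/

section LowenheimSkolem

variable {κ : Cardinal.{u}} {M N Y x s t : ZFSet.{u}}

theorem card_setLang_le : setLang.card ≤ Cardinal.aleph0 := by
  have hfun : ∀ n, Countable (setLang.Functions n) := fun _ => inferInstanceAs (Countable Empty)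
  have hrel : ∀ n, Countable (setLang.Relations n) := by
    intro n
    have : Subsingleton (setLang.Relations n) := ⟨fun a b => by cases a; cases b; rfl⟩
    infer_instance
  exact Cardinal.mk_le_aleph0_iff.2 inferInstance

theorem exists_elemSub_of_elementarySubstructure (S : setLang.ElementarySubstructure N) :
    ∃ Y : ZFSet.{u}, ElemSub Y N ∧ (∀ x, x ∈ Y ↔ ∃ h : x ∈ N, (⟨x, h⟩ : N) ∈ S) ∧
      Cardinal.lift.{u + 1} Y.card = Cardinal.mk S := by
  let Y := ZFSet.sep (fun x => ∃ h : x ∈ N, (⟨x, h⟩ : N) ∈ S) N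
  have hY : ∀ x, x ∈ Y ↔ ∃ h : x ∈ N, (⟨x, h⟩ : N) ∈ S := fun x => by
    rw [ZFSet.mem_sep]
    exact and_iff_right_of_imp fun h => h.1
  let e : Y ≃[setLang] S :=
    { toFun := fun x => ⟨⟨x, ((hY _).1 x.2).1⟩, ((hY _).1 x.2).2⟩
      invFun := fun x => ⟨x.1.1, (hY _).2 ⟨x.1.2, x.2⟩⟩
      left_inv := fun _ => rfl
      right_inv := fun _ => rfl
      map_fun' := fun g => Empty.elim g
      map_rel' := fun r _ => by cases r; exact Iff.rfl }
  exact ⟨Y, ⟨S.subtype.comp e.toElementaryEmbedding, fun _ => rfl⟩, hY,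
    ZFSet.cardinalMk_coe_sort.symm.trans (Cardinal.mk_congr e.toEquiv)⟩

theorem exists_elemSub_card_eq (hκ : Cardinal.aleph0 ≤ κ) (hs : s ⊆ N) (hsc : s.card ≤ κ)
    (hN : κ ≤ N.card) : ∃ Y : ZFSet.{u}, s ⊆ Y ∧ ElemSub Y N ∧ Y.card = κ := by
  have hs' : Cardinal.mk {x : N | x.1 ∈ s} ≤ Cardinal.lift.{u + 1} κ := by
    have hle : Cardinal.mk {x : N | x.1 ∈ s} ≤ Cardinal.mk s :=
      Cardinal.mk_le_of_injective (f := fun x => ⟨x.1.1, x.2⟩) fun x y h =>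
        Subtype.ext (Subtype.ext (congrArg Subtype.val h :))
    rw [ZFSet.cardinalMk_coe_sort] at hle
    exact hle.trans (Cardinal.lift_le.2 hsc)
  obtain ⟨S, hS, hSc⟩ := Language.exists_elementarySubstructure_card_eq setLang
    (M := N) {x : N | x.1 ∈ s} κ hκ
    (by rw [Cardinal.lift_id'.{u, u + 1}]; exact hs')
    (by
      have hle := Cardinal.lift_le.{u}.2 card_setLang_le
      rw [Cardinal.lift_aleph0] at hle
      exact hle.trans (by simpa using hκ))
    (by simpa [ZFSet.cardinalMk_coe_sort] using hN)
  obtain ⟨Y, hYN, hY, hYc⟩ := exists_elemSub_of_elementarySubstructure S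
  refine ⟨Y, fun x hx => (hY x).2 ⟨hs hx, hS hx⟩, hYN, Cardinal.lift_injective.{u + 1} ?_⟩
  rw [hYc, ← hSc, Cardinal.lift_id'.{u, u + 1}]

theorem exists_elemSub_range_inter_subset (hκ : Cardinal.aleph0 ≤ κ) (hM : M.card = κ)
    (hN : κ ≤ N.card) (j : M ↪ₑ[setLang] N) :
    ∃ Y : ZFSet.{u}, ElemSub Y N ∧ Y.card = κ ∧ (∀ x ∈ M, app j x ∈ Y) ∧ M ∩ N ⊆ Y := by
  have hsub : ZFSet.range (fun x : M => (j x).1) ∪ (M ∩ N) ⊆ N := by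
    intro x hx
    rcases ZFSet.mem_union.1 hx with hx | hx
    · obtain ⟨y, rfl⟩ := ZFSet.mem_range.1 hx
      exact (j y).2
    · exact (ZFSet.mem_inter.1 hx).2
  have hcard : (ZFSet.range (fun x : M => (j x).1) ∪ (M ∩ N)).card ≤ κ :=
    ZFSet.card_union_le.trans (Cardinal.add_le_of_le hκ ((card_range_le _).trans hM.le)
      ((ZFSet.card_mono fun x hx => (ZFSet.mem_inter.1 hx).1).trans hM.le))
  obtain ⟨Y, hsY, hYN, hYc⟩ := exists_elemSub_card_eq hκ hsub hcard hN
  exact ⟨Y, hYN, hYc,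
    fun x hx => hsY (ZFSet.mem_union.2 (Or.inl (ZFSet.mem_range.2 ⟨⟨x, hx⟩,
      (app_of_mem j hx).symm⟩))),
    fun x hx => hsY (ZFSet.mem_union.2 (Or.inr hx))⟩

theorem exists_embedding_collapseImage (hN : N.IsTransitive) (hYN : ElemSub Y N)
    (j : M ↪ₑ[setLang] N) (hjY : ∀ x ∈ M, app j x ∈ Y) :
    ∃ j' : M ↪ₑ[setLang] collapseImage Y, ∀ x : M, (j' x : ZFSet.{u}) = collapse Y (j x) := by
  obtain ⟨j₁, hj₁⟩ := exists_elementaryEmbedding (app j) hjY fun _ φ v hv => by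
    rw [realizeIn_app j φ hv, hYN.realizeIn_iff φ fun i => hjY _ (hv i)]
  obtain ⟨e, he⟩ := exists_collapse_embedding (hYN.extensional hN)
  exact ⟨e.comp j₁, fun x => by
    rw [Language.ElementaryEmbedding.comp_apply, he, hj₁, app_of_mem j x.2]⟩

theorem subset_of_collapse_subset (hN : N.IsTransitive) (hYN : ElemSub Y N)
    (ht : t.IsTransitive) (htY : t ⊆ Y) (htY' : t ∈ Y) (hx : x ∈ Y) (hxt : collapse Y x ⊆ t) :
    x ⊆ t := by
  intro z hz
  by_contra hzt
  obtain ⟨z, hzY, hz, hzt⟩ := hYN.exists_mem hN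
    (R := fun z _ (v : Fin 2 → ZFSet.{u}) => z ∈ v 0 ∧ z ∉ v 1)
    inferInstance ![x, t] (by simp [Fin.forall_fin_succ, hx, htY'])
    ⟨z, hN _ (hYN.subset hx) hz, hz, hzt⟩
  have hcol := hxt (mem_collapse.2 ⟨z, hzY, hz, rfl⟩)
  have heq := collapse_injOn (hYN.extensional hN) _ (htY hcol) _ hzY
    (collapse_eq_self_of_subset ht htY (ht _ hcol))
  exact hzt (heq ▸ hcol)

theorem PowersetPreserving.exists_small (hκ : Cardinal.aleph0 ≤ κ) (hM : M.card = κ)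
    (hκM : cardSet κ ∈ M) (hκM' : cardSet κ ⊆ M) (hN : N.IsTransitive)
    {j : M ↪ₑ[setLang] N} (hj : PowersetPreserving κ j) :
    ∃ N' : ZFSet.{u}, N'.IsTransitive ∧ N'.card ≤ κ ∧
      ∃ j' : M ↪ₑ[setLang] N', PowersetPreserving κ j' := by
  have hκN : cardSet κ ∈ N := (hj.same_subsets _ fun _ h => h).1 hκM
  have hNc : κ ≤ N.card := card_cardSet κ ▸ ZFSet.card_mono (hN _ hκN)
  obtain ⟨Y, hYN, hYc, hjY, hMN⟩ := exists_elemSub_range_inter_subset hκ hM hNc j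
  obtain ⟨j', hj'⟩ := exists_embedding_collapseImage hN hYN j hjY
  have hκY : cardSet κ ∈ Y := hMN (ZFSet.mem_inter.2 ⟨hκM, hκN⟩)
  have hκY' : cardSet κ ⊆ Y := fun x hx => hMN (ZFSet.mem_inter.2 ⟨hκM' hx, hN _ hκN hx⟩)
  have htr := (isOrdinal_cardSet κ).isTransitive
  have hfix : ∀ x ⊆ cardSet κ, collapse Y x = x := fun _ hx =>
    collapse_eq_self_of_subset htr hκY' hx
  refine ⟨collapseImage Y, isTransitive_collapseImage, (card_range_le _).trans hYc.le,
    j', ?_, ?_, fun A hA => ⟨fun hAM => ?_, fun hAN => ?_⟩⟩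
  · intro x hx
    rw [hj', hj.fixes x hx]
    exact hfix _ (htr _ hx)
  · obtain ⟨x, hx, hne⟩ := hj.moves
    refine ⟨x, hx, fun h => hne ?_⟩
    refine collapse_injOn (hYN.extensional hN) _ (app_of_mem j x.2 ▸ hjY _ x.2) _ (hx ▸ hκY) ?_
    rw [← hj', h, hfix _ hx.le]
  · exact mem_collapseImage.2
      ⟨A, hMN (ZFSet.mem_inter.2 ⟨hAM, (hj.same_subsets A hA).1 hAM⟩), hfix A hA⟩
  · obtain ⟨x, hx, rfl⟩ := mem_collapseImage.1 hAN
    have hxκ : x ⊆ cardSet κ := subset_of_collapse_subset hN hYN htr hκY' hκY hx hA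
    rw [hfix x hxκ]
    exact (hj.same_subsets x hxκ).2 (hYN.subset hx)

end LowenheimSkolem

/-! ### Restricting an embedding to `H(κ⁺)` -/

/-- In the sense of `W`, the set `X` is `H(ν⁺)`: it consists of the elements of the transitive sets
that are images of `ν`. -/
def IsHSucc (W ν X : ZFSet.{u}) : Prop :=
  ∀ y ∈ W, y ∈ X ↔ ∃ t ∈ W, ∃ f ∈ W, Enumerates ν t f ∧ y ∈ t

instance UniformlyDefinable.isHSucc {α : Type} {a b : α} :
    UniformlyDefinable (fun (W : ZFSet.{u}) v => IsHSucc W (v a) (v b)) := by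
  unfold IsHSucc
  infer_instance

theorem isHSucc_unique {W ν X Y : ZFSet.{u}} (hW : W.IsTransitive) (hX : X ∈ W) (hY : Y ∈ W)
    (h : IsHSucc W ν X) (h' : IsHSucc W ν Y) : X = Y :=
  ZFSet.ext fun y => ⟨fun hy => (h' y (hW _ hX hy)).2 ((h y (hW _ hX hy)).1 hy),
    fun hy => (h y (hW _ hY hy)).2 ((h' y (hW _ hY hy)).1 hy)⟩

theorem isHSucc_H {ν θ : Cardinal.{u}} (hν : Cardinal.aleph0 ≤ ν) (h : Order.succ ν ≤ θ) :
    IsHSucc (H θ) (cardSet ν) (H (Order.succ ν)) := by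
  have hsub := H_subset_H h
  have hk := cardSet_mem_H (Order.lt_succ ν)
  intro y _
  rw [mem_H_succ_iff hν]
  constructor
  · rintro ⟨t, f, he, hy⟩
    exact ⟨t, hsub (he.mem_H_left hk), f,
      hsub (he.mem_H_right (Cardinal.isRegular_succ hν) hk), he, hy⟩
  · rintro ⟨t, -, f, -, h⟩
    exact ⟨t, f, h⟩

theorem eq_empty_or_exists_max_of_mem_cardSet_aleph0 {x : ZFSet.{u}}
    (hx : x ∈ cardSet Cardinal.aleph0.{u}) :
    (∀ z ∈ x, False) ∨ ∃ y ∈ x, ∀ z ∈ x, z ∈ y ∨ z = y := by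
  rw [cardSet, Cardinal.ord_aleph0] at hx
  obtain ⟨a, ha, rfl⟩ := Ordinal.mem_toZFSet_iff.1 hx
  obtain ⟨n, rfl⟩ := Ordinal.lt_omega0.1 ha
  rcases n with _ | n
  · exact Or.inl (by simp)
  · right
    rw [Nat.cast_succ, Ordinal.toZFSet_add_one]
    refine ⟨_, ZFSet.mem_insert _ _, fun z hz => ?_⟩
    rwa [ZFSet.mem_insert_iff, or_comm] at hz

theorem cardSet_mem_cardSet {μ ν : Cardinal.{u}} : cardSet μ ∈ cardSet ν ↔ μ < ν :=
  Ordinal.toZFSet_mem_toZFSet_iff.trans Cardinal.ord_lt_ord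

/-- The embedding `j : M → N` is one of those that occur in the definition of `α`-Ramsey cardinals,
for a `θ` that is so large that `H(κ⁺)` is an element of `H(θ)`. The closure of `M` under
`<α`-sequences is not part of this notion. -/
structure IsRamseyEmbedding (κ θ : Cardinal.{u}) {M N : ZFSet.{u}} (j : M ↪ₑ[setLang] N) :
    Prop where
  isRegular : κ.IsRegular
  isRegular_target : θ.IsRegular
  H_succ_mem_H : H (Order.succ κ) ∈ H θ
  isWeakModel : IsWeakModel κ M
  elemSub : ElemSub M (H θ)
  isTransitive : N.IsTransitive
  powersetPreserving : PowersetPreserving κ j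

theorem AlphaRamsey.exists_isRamseyEmbedding {α κ : Cardinal.{u}} (h : AlphaRamsey α κ) :
    ∃ θ : Cardinal.{u}, ∀ A : ZFSet.{u}, A ⊆ cardSet κ → ∃ M N : ZFSet.{u},
      ∃ j : M ↪ₑ[setLang] N, IsRamseyEmbedding κ θ j ∧ A ∈ M ∧ ClosedUnderSeq α M := by
  obtain ⟨-, hκ, -, h⟩ := h
  obtain ⟨θ, hle, hθ, h⟩ := h (Order.succ (H (Order.succ κ)).card)
  refine ⟨θ, fun A hA => ?_⟩
  obtain ⟨M, hAM, hM, hMH, hc, N, hN, j, hj⟩ := h A hA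
  exact ⟨M, N, j, ⟨hκ, hθ, mem_H_of_isTransitive isTransitive_H ((Order.lt_succ _).trans_le hle),
    hM, hMH, hN, hj⟩, hAM, hc⟩

namespace IsRamseyEmbedding

variable {κ θ : Cardinal.{u}} {M N : ZFSet.{u}} {j : M ↪ₑ[setLang] N}
  (hj : IsRamseyEmbedding κ θ j)
include hj

theorem transfer {α : Type} {P : ZFSet.{u} → (α → ZFSet.{u}) → Prop} (hP : UniformlyDefinable P)
    (v : α → ZFSet.{u}) (hv : ∀ a, v a ∈ M) : P (H θ) v ↔ P N (fun a => app j (v a)) :=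
  hP.transfer hj.elemSub isTransitive_H hj.isTransitive j v hv

theorem exists_mem {α : Type} {R : ZFSet.{u} → ZFSet.{u} → (α → ZFSet.{u}) → Prop}
    (hR : UniformlyDefinable (fun W (v : Option α → ZFSet.{u}) =>
      R (v none) W (fun a => v (some a))))
    (v : α → ZFSet.{u}) (hv : ∀ a, v a ∈ M) (hx : ∃ x ∈ H θ, R x (H θ) v) :
    ∃ x ∈ M, R x (H θ) v :=
  hj.elemSub.exists_mem isTransitive_H hR v hv hx

theorem succ_le : Order.succ κ ≤ θ := by
  have hcard : (ZFSet.powerset (cardSet κ)).card = 2 ^ κ := by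
    rw [ZFSet.card_powerset, card_cardSet]
  have hsub : ZFSet.powerset (cardSet κ) ⊆ H (Order.succ κ) := fun x hx =>
    mem_H_of_subset (cardSet_mem_H (Order.lt_succ κ)) (ZFSet.mem_powerset.1 hx)
  have hlt : κ < (H (Order.succ κ)).card :=
    (Cardinal.cantor κ).trans_le (hcard ▸ ZFSet.card_mono hsub)
  exact (Order.succ_le_of_lt hlt).trans (card_lt_of_mem_H hj.H_succ_mem_H).le

theorem app_mem_app_iff {x y : ZFSet.{u}} (hx : x ∈ M) (hy : y ∈ M) :
    app j x ∈ app j y ↔ x ∈ y :=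
  (hj.transfer (P := fun _ (v : Fin 2 → ZFSet.{u}) => v 0 ∈ v 1) inferInstance
    ![x, y] (by simp [Fin.forall_fin_succ, hx, hy])).symm

theorem app_eq_self {a : ZFSet.{u}} (ha : a ∈ cardSet κ) : app j a = a := by
  rw [app_of_mem j (hj.isWeakModel.subset ha)]
  exact hj.powersetPreserving.fixes _ ha

theorem app_cardSet_ne : app j (cardSet κ) ≠ cardSet κ := by
  obtain ⟨⟨x, hx⟩, rfl, hne⟩ := hj.powersetPreserving.moves
  rwa [app_of_mem j hx]

theorem mem_app_iff {a x : ZFSet.{u}} (ha : a ∈ cardSet κ) (hx : x ∈ M) :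
    a ∈ app j x ↔ a ∈ x := by
  rw [← hj.app_mem_app_iff (hj.isWeakModel.subset ha) hx, hj.app_eq_self ha]

theorem cardSet_mem_target : cardSet κ ∈ N :=
  (hj.powersetPreserving.same_subsets _ fun _ h => h).1 hj.isWeakModel.mem

theorem isOrdinal_app_cardSet : (app j (cardSet κ)).IsOrdinal :=
  (hj.transfer (P := fun _ (v : Fin 1 → ZFSet.{u}) => (v 0).IsOrdinal) inferInstance
    ![cardSet κ] (by simp [hj.isWeakModel.mem])).1 (isOrdinal_cardSet κ)

theorem cardSet_subset_app : cardSet κ ⊆ app j (cardSet κ) :=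
  fun _ ha => (hj.mem_app_iff ha hj.isWeakModel.mem).2 ha

theorem cardSet_mem_app : cardSet κ ∈ app j (cardSet κ) :=
  (((isOrdinal_cardSet κ).subset_iff_eq_or_mem hj.isOrdinal_app_cardSet).1
    hj.cardSet_subset_app).resolve_left hj.app_cardSet_ne.symm

theorem aleph0_lt : Cardinal.aleph0 < κ := by
  refine hj.isRegular.aleph0_le.lt_of_ne fun hω => ?_
  have hsucc : ∀ y ∈ cardSet κ, insert y y ∈ cardSet κ := hω ▸ fun y => insert_mem_cardSet_aleph0
  have happ := (hj.transfer (P := fun _ (v : Fin 1 → ZFSet.{u}) => ∀ x ∈ v 0,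
      (∀ z ∈ x, False) ∨ ∃ y ∈ x, ∀ z ∈ x, z ∈ y ∨ z = y) inferInstance
    ![cardSet κ] (by simp [hj.isWeakModel.mem])).1
    (hω ▸ fun _ => eq_empty_or_exists_max_of_mem_cardSet_aleph0)
  rcases happ _ hj.cardSet_mem_app with hempty | ⟨y, hy, hmax⟩
  · exact hempty _ (empty_mem_cardSet hω.le)
  · rcases hmax _ (hsucc y hy) with hmem | heq
    · exact ZFSet.mem_asymm hmem (ZFSet.mem_insert _ _)
    · have hmem := ZFSet.mem_insert y y
      rw [heq] at hmem
      exact ZFSet.mem_irrefl y hmem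

theorem aleph0_lt_target : Cardinal.aleph0 < θ :=
  hj.aleph0_lt.trans (Order.succ_le_iff.1 hj.succ_le)

theorem H_succ_mem : H (Order.succ κ) ∈ M := by
  have hH := isHSucc_H hj.isRegular.aleph0_le hj.succ_le
  obtain ⟨X, hX, h⟩ := hj.exists_mem
    (R := fun X W (v : Fin 1 → ZFSet.{u}) => IsHSucc W (v 0) X)
    inferInstance ![cardSet κ] (by simp [hj.isWeakModel.mem]) ⟨_, hj.H_succ_mem_H, hH⟩
  rwa [isHSucc_unique isTransitive_H hj.H_succ_mem_H (hj.elemSub.subset hX) hH h]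

theorem exists_enumerates {x : ZFSet.{u}} (hx : x ∈ M) (hx' : x ∈ H (Order.succ κ)) :
    ∃ t ∈ M, ∃ f ∈ M, Enumerates (cardSet κ) t f ∧ x ∈ t := by
  obtain ⟨t, ht, f, hf, he, hxt⟩ := (isHSucc_H hj.isRegular.aleph0_le hj.succ_le x
    (hj.elemSub.subset hx)).1 hx'
  exact hj.elemSub.exists_enumerates isTransitive_H hj.isWeakModel.mem hx ht hf he hxt

theorem enumerates_subset {t f : ZFSet.{u}} (ht : t ∈ M) (hf : f ∈ M)
    (he : Enumerates (cardSet κ) t f) : t ⊆ M :=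
  hj.elemSub.enumerates_subset isTransitive_H hj.isWeakModel.subset ht hf he

theorem isTransitive_inter : (M ∩ H (Order.succ κ)).IsTransitive := by
  intro x hx y hy
  rw [ZFSet.mem_inter] at hx
  obtain ⟨t, ht, f, hf, he, hxt⟩ := hj.exists_enumerates hx.1 hx.2
  exact ZFSet.mem_inter.2
    ⟨hj.enumerates_subset ht hf he (he.1 _ hxt hy), isTransitive_H _ hx.2 hy⟩

theorem elemSub_inter : ElemSub (M ∩ H (Order.succ κ)) (H (Order.succ κ)) :=
  hj.elemSub.inter isTransitive_H hj.H_succ_mem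

theorem cardSet_mem_inter : cardSet κ ∈ M ∩ H (Order.succ κ) :=
  ZFSet.mem_inter.2 ⟨hj.isWeakModel.mem, cardSet_mem_H (Order.lt_succ κ)⟩

theorem isWeakModel_inter : IsWeakModel κ (M ∩ H (Order.succ κ)) where
  card_eq := le_antisymm
    ((ZFSet.card_mono fun _ hx => (ZFSet.mem_inter.1 hx).1).trans hj.isWeakModel.card_eq.le)
    ((card_cardSet κ).symm.le.trans
      (ZFSet.card_mono (hj.isTransitive_inter _ hj.cardSet_mem_inter)))
  subset := hj.isTransitive_inter _ hj.cardSet_mem_inter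
  mem := hj.cardSet_mem_inter
  models := hj.elemSub_inter.modelsZFCMinus (Cardinal.isRegular_succ hj.isRegular.aleph0_le)
    (Order.lt_succ_iff.2 hj.isRegular.aleph0_le) hj.isTransitive_inter

theorem closedUnderSeq_inter {α : Cardinal.{u}} (hα : α ≤ κ) (hM : ClosedUnderSeq α M) :
    ClosedUnderSeq α (M ∩ H (Order.succ κ)) := by
  intro β hβ f hf
  have hβ' : β.toZFSet ∈ H (Order.succ κ) :=
    toZFSet_mem_H ((Cardinal.lt_ord.1 hβ).trans_le (hα.trans (Order.le_succ κ)))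
  refine ZFSet.mem_inter.2 ⟨hM β hβ f ⟨fun p hp => ?_, hf.2⟩,
    isFunc_mem_H (Cardinal.isRegular_succ hj.isRegular.aleph0_le) hβ' hj.elemSub_inter.subset hf⟩
  obtain ⟨a, ha, b, hb, rfl⟩ := ZFSet.mem_prod.1 (hf.1 hp)
  exact ZFSet.pair_mem_prod.2 ⟨ha, (ZFSet.mem_inter.1 hb).1⟩

theorem exists_restriction : ∃ j' : (M ∩ H (Order.succ κ) : ZFSet.{u}) ↪ₑ[setLang]
    (app j (H (Order.succ κ))), ∀ x, (j' x : ZFSet.{u}) = app j x := by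
  refine exists_elementaryEmbedding (app j) (fun x hx => ?_) fun n φ v hv => ?_
  · obtain ⟨hxM, hxH⟩ := ZFSet.mem_inter.1 hx
    exact (hj.app_mem_app_iff hxM hj.H_succ_mem).2 hxH
  · rw [hj.elemSub_inter.realizeIn_iff φ hv]
    exact hj.transfer (UniformlyDefinable.realizeIn (f := some) (a := none))
      (fun o : Option (Fin n) => o.elim (H (Order.succ κ)) v) (by
        rintro (_ | i)
        exacts [hj.H_succ_mem, (ZFSet.mem_inter.1 (hv i)).1])

theorem isTransitive_app_H_succ : (app j (H (Order.succ κ))).IsTransitive :=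
  (hj.transfer (P := fun _ (v : Fin 1 → ZFSet.{u}) => (v 0).IsTransitive) inferInstance
    ![H (Order.succ κ)] (by simp [hj.H_succ_mem])).1 isTransitive_H

theorem mem_app_H_succ_iff {A : ZFSet.{u}} (hA : A ⊆ cardSet κ) :
    A ∈ app j (H (Order.succ κ)) ↔ A ∈ N := by
  refine ⟨fun h => hj.isTransitive _ (app_mem j hj.H_succ_mem) h, fun hAN => ?_⟩
  have hpow := (hj.transfer
    (P := fun W (v : Fin 2 → ZFSet.{u}) => ∀ x ∈ W, x ⊆ v 0 → x ∈ v 1)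
    inferInstance ![cardSet κ, H (Order.succ κ)]
    (by simp [Fin.forall_fin_succ, hj.isWeakModel.mem, hj.H_succ_mem])).1
    (fun _ _ hx => mem_H_of_subset (cardSet_mem_H (Order.lt_succ κ)) hx)
  exact hpow A hAN (hA.trans hj.cardSet_subset_app)

theorem hasPowersetPreservingEmbedding_inter :
    HasPowersetPreservingEmbedding κ (M ∩ H (Order.succ κ)) := by
  obtain ⟨j', hj'⟩ := hj.exists_restriction
  refine ⟨_, hj.isTransitive_app_H_succ, j', fun x hx => ?_,
    ⟨⟨cardSet κ, hj.cardSet_mem_inter⟩, rfl, ?_⟩, fun A hA => ?_⟩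
  · rw [hj', hj.app_eq_self hx]
  · rw [hj']
    exact hj.app_cardSet_ne
  · have hAH : A ∈ H (Order.succ κ) := mem_H_of_subset (cardSet_mem_H (Order.lt_succ κ)) hA
    rw [ZFSet.mem_inter, and_iff_left hAH, hj.powersetPreserving.same_subsets A hA,
      hj.mem_app_H_succ_iff hA]

end IsRamseyEmbedding

/-! ### Coding transitive sets by subsets of `κ` -/

section Coding

variable {k p e t t' f f' : ZFSet.{u}}

theorem Enumerates.mem_iff (h : Enumerates k t f) {y : ZFSet.{u}} :
    y ∈ t ↔ ∃ a ∈ k, y = val f a := by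
  constructor
  · intro hy
    obtain ⟨a, ha, hp⟩ := h.2.2 y hy
    exact ⟨a, ha, (pair_mem_iff_of_isFunc h.2.1 ha).1 hp⟩
  · rintro ⟨a, ha, rfl⟩
    exact val_mem h.2.1 ha

theorem Enumerates.eq (h : Enumerates k t f) (h' : Enumerates k t' f')
    (hf : ∀ a ∈ k, ∀ z ∈ t', z ∈ val f' a ↔ ∃ b ∈ k, z = val f' b ∧ val f b ∈ val f a) :
    t' = t ∧ f' = f := by
  have val_eq_of_eq : ∀ x : ZFSet.{u}, ∀ a ∈ k, val f a = x → val f' a = x := by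
    intro x
    induction x using ZFSet.inductionOn with
    | _ x ih =>
      rintro a ha rfl
      ext z
      constructor
      · intro hz
        obtain ⟨b, hb, rfl, hba⟩ := (hf a ha z (h'.1 _ (val_mem h'.2.1 ha) hz)).1 hz
        rwa [ih _ hba b hb rfl]
      · intro hz
        obtain ⟨b, hb, rfl⟩ := h.mem_iff.1 (h.1 _ (val_mem h.2.1 ha) hz)
        rw [← ih _ hz b hb rfl]
        exact (hf a ha _ (val_mem h'.2.1 hb)).2 ⟨b, hb, rfl, hz⟩
  have val_eq : ∀ a ∈ k, val f' a = val f a := fun a ha => val_eq_of_eq _ a ha rfl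
  constructor
  · ext y
    rw [h.mem_iff, h'.mem_iff]
    exact exists_congr fun a => and_congr_right fun ha => by rw [val_eq a ha]
  · rw [eq_graph_of_isFunc h.2.1, eq_graph_of_isFunc h'.2.1]
    exact graph_congr val_eq

/-- The function `f` enumerates the transitive collapse `t` of the relation `h b ∈ h a` on `k`. -/
def Collapses (k h t f : ZFSet.{u}) : Prop :=
  Enumerates k t f ∧ ∀ a ∈ k, ∀ z ∈ t, z ∈ val f a ↔ ∃ b ∈ k, z = val f b ∧ val h b ∈ val h a

instance UniformlyDefinable.collapses {α : Type} {a b c d : α} :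
    UniformlyDefinable (fun (_ : ZFSet.{u}) v => Collapses (v a) (v b) (v c) (v d)) := by
  unfold Collapses
  infer_instance

theorem exists_collapses (k h : ZFSet.{u}) : ∃ t f, Collapses k h t f := by
  let Y := ZFSet.range (fun a : k => val h a)
  have mem_Y {w} : w ∈ Y ↔ ∃ a ∈ k, val h a = w := by simp [Y]
  have val_mem_Y {a} (ha : a ∈ k) : val h a ∈ Y := mem_Y.2 ⟨a, ha, rfl⟩
  have val_graph_eq {a} (ha : a ∈ k) :
      val (graph k fun a => collapse Y (val h a)) a = collapse Y (val h a) := val_graph ha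
  refine ⟨collapseImage Y, graph k (fun a => collapse Y (val h a)),
    ⟨isTransitive_collapseImage,
      isFunc_graph fun a ha => mem_collapseImage.2 ⟨_, val_mem_Y ha, rfl⟩, fun y hy => ?_⟩,
    fun a ha z _ => ?_⟩
  · obtain ⟨w, hw, rfl⟩ := mem_collapseImage.1 hy
    obtain ⟨a, ha, rfl⟩ := mem_Y.1 hw
    exact ⟨a, ha, pair_mem_graph.2 ⟨ha, rfl⟩⟩
  · rw [val_graph_eq ha, mem_collapse]
    constructor
    · rintro ⟨w, hw, hwa, rfl⟩
      obtain ⟨b, hb, rfl⟩ := mem_Y.1 hw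
      exact ⟨b, hb, (val_graph_eq hb).symm, hwa⟩
    · rintro ⟨b, hb, rfl, hba⟩
      exact ⟨_, val_mem_Y hb, hba, (val_graph_eq hb).symm⟩

/-- The function `p` enumerates the ordered pairs of elements of `k` with index set `k`. -/
def EnumeratesPairs (k p : ZFSet.{u}) : Prop :=
  (∀ a ∈ k, ∀ b ∈ k, ∃ c ∈ k, ZFSet.pair c (ZFSet.pair a b) ∈ p) ∧
    ∀ c ∈ k, ∀ a ∈ k, ∀ b ∈ k, ∀ a' ∈ k, ∀ b' ∈ k, ZFSet.pair c (ZFSet.pair a b) ∈ p →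
      ZFSet.pair c (ZFSet.pair a' b') ∈ p → a = a' ∧ b = b'

instance UniformlyDefinable.enumeratesPairs {α : Type} {a b : α} :
    UniformlyDefinable (fun (_ : ZFSet.{u}) v => EnumeratesPairs (v a) (v b)) := by
  unfold EnumeratesPairs
  infer_instance

theorem exists_enumeratesPairs {κ : Cardinal.{u}} (hκ : Cardinal.aleph0 ≤ κ) :
    ∃ p ∈ H (Order.succ κ), EnumeratesPairs (cardSet κ) p := by
  have hr := Cardinal.isRegular_succ hκ
  have cardSet_mem := cardSet_mem_H (Order.lt_succ κ)
  have prod_mem := prod_mem_H hr cardSet_mem cardSet_mem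
  have empty_mem := empty_mem_cardSet hκ
  have card_prod_le := Order.lt_succ_iff.1 (card_lt_of_mem_H prod_mem)
  obtain ⟨F, mapsTo, surj⟩ := exists_surj_of_card_le (card_prod_le.trans_eq (card_cardSet κ).symm)
    ⟨_, ZFSet.pair_mem_prod.2 ⟨empty_mem, empty_mem⟩⟩
  refine ⟨graph (cardSet κ) F,
    graph_mem_H hr cardSet_mem fun c hc => isTransitive_H _ prod_mem (mapsTo c hc),
    fun a ha b hb => ?_, fun c _ a _ b _ a' _ b' _ h h' => ?_⟩
  · obtain ⟨c, hc, hFc⟩ := surj _ (ZFSet.pair_mem_prod.2 ⟨ha, hb⟩)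
    exact ⟨c, hc, pair_mem_graph.2 ⟨hc, hFc.symm⟩⟩
  · exact ZFSet.pair_inj.1 ((pair_mem_graph.1 h).2.trans (pair_mem_graph.1 h').2.symm)

/-- Through the enumeration `p` of pairs, the set `e` codes the relation `f a ∈ f b` on `k`. -/
def IsMembershipCode (k p e f : ZFSet.{u}) : Prop :=
  ∀ a ∈ k, ∀ b ∈ k, ∀ c ∈ k, ZFSet.pair c (ZFSet.pair a b) ∈ p → (c ∈ e ↔ val f a ∈ val f b)

instance UniformlyDefinable.isMembershipCode {α : Type} {a b c d : α} :
    UniformlyDefinable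
      (fun (_ : ZFSet.{u}) v => IsMembershipCode (v a) (v b) (v c) (v d)) := by
  unfold IsMembershipCode
  infer_instance

theorem EnumeratesPairs.exists_isMembershipCode (hp : EnumeratesPairs k p) (f : ZFSet.{u}) :
    ∃ e ⊆ k, IsMembershipCode k p e f := by
  refine ⟨ZFSet.sep (fun c => ∃ a ∈ k, ∃ b ∈ k, ZFSet.pair c (ZFSet.pair a b) ∈ p ∧
    val f a ∈ val f b) k, ZFSet.sep_subset, fun a ha b hb c hc hcab => ?_⟩
  rw [ZFSet.mem_sep, and_iff_right hc]
  constructor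
  · rintro ⟨a', ha', b', hb', hcab', h⟩
    obtain ⟨rfl, rfl⟩ := hp.2 c hc a ha b hb a' ha' b' hb' hcab hcab'
    exact h
  · exact fun h => ⟨a, ha, b, hb, hcab, h⟩

theorem Enumerates.eq_of_isMembershipCode (h : Enumerates k t f) (h' : Enumerates k t' f')
    (hp : EnumeratesPairs k p) (he : IsMembershipCode k p e f) (he' : IsMembershipCode k p e f') :
    t' = t ∧ f' = f := by
  have val_mem_iff : ∀ a ∈ k, ∀ b ∈ k, val f a ∈ val f b ↔ val f' a ∈ val f' b := by
    intro a ha b hb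
    obtain ⟨c, hc, hcab⟩ := hp.1 a ha b hb
    rw [← he a ha b hb c hc hcab, he' a ha b hb c hc hcab]
  refine h.eq h' fun a ha z hz => ⟨fun hza => ?_, ?_⟩
  · obtain ⟨b, hb, rfl⟩ := h'.mem_iff.1 hz
    exact ⟨b, hb, rfl, (val_mem_iff b hb a ha).2 hza⟩
  · rintro ⟨b, hb, rfl, hba⟩
    exact (val_mem_iff b hb a ha).1 hba

end Coding

namespace IsRamseyEmbedding

variable {κ θ : Cardinal.{u}} {M N t f : ZFSet.{u}} {j : M ↪ₑ[setLang] N}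
  (hj : IsRamseyEmbedding κ θ j)
include hj

theorem app_val {a : ZFSet.{u}} (hf : f ∈ M) (ha : a ∈ cardSet κ) (hfa : val f a ∈ M) :
    app j (val f a) = val (app j f) a := by
  have app_val_app := (hj.transfer
    (P := fun _ (v : Fin 3 → ZFSet.{u}) => v 0 = val (v 1) (v 2)) inferInstance
    ![val f a, f, a] (by simp [Fin.forall_fin_succ, hfa, hf, hj.isWeakModel.subset ha])).1 rfl
  change app j (val f a) = val (app j f) (app j a) at app_val_app
  rwa [hj.app_eq_self ha] at app_val_app

theorem exists_collapses_target {k h : ZFSet.{u}} (hk : k ∈ N) (hh : h ∈ N) :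
    ∃ t ∈ N, ∃ f ∈ N, Collapses k h t f := by
  refine (hj.transfer (P := fun W (_ : Fin 0 → ZFSet.{u}) =>
    ∀ k ∈ W, ∀ h ∈ W, ∃ t ∈ W, ∃ f ∈ W, Collapses k h t f) inferInstance ![] (by simp)).1
    (fun k hk h _ => ?_) k hk h hh
  obtain ⟨t, f, htf⟩ := exists_collapses k h
  exact ⟨t, htf.1.mem_H_left hk, f, htf.1.mem_H_right hj.isRegular_target hk, htf⟩

theorem enumerates_mem_target (ht : t ∈ M) (hf : f ∈ M) (he : Enumerates (cardSet κ) t f) :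
    t ∈ N ∧ f ∈ N := by
  obtain ⟨t', ht', f', hf', he', mem_val_iff⟩ :=
    hj.exists_collapses_target hj.cardSet_mem_target (app_mem j hf)
  have val_mem_M : ∀ a ∈ cardSet κ, val f a ∈ M := fun a ha =>
    hj.enumerates_subset ht hf he (val_mem he.2.1 ha)
  obtain ⟨rfl, rfl⟩ := he.eq he' fun a ha z hz => by
    rw [mem_val_iff a ha z hz]
    refine exists_congr fun b => and_congr_right fun hb => and_congr_right fun _ => ?_
    rw [← hj.app_val hf ha (val_mem_M a ha), ← hj.app_val hf hb (val_mem_M b hb),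
      hj.app_mem_app_iff (val_mem_M b hb) (val_mem_M a ha)]
  exact ⟨ht', hf'⟩

theorem mem_target {x : ZFSet.{u}} (hx : x ∈ M) (hx' : x ∈ H (Order.succ κ)) : x ∈ N := by
  obtain ⟨t, ht, f, hf, he, hxt⟩ := hj.exists_enumerates hx hx'
  exact hj.isTransitive _ (hj.enumerates_mem_target ht hf he).1 hxt

theorem exists_enumeratesPairs_mem : ∃ p ∈ M, p ∈ N ∧ EnumeratesPairs (cardSet κ) p := by
  obtain ⟨p, hp, h⟩ := exists_enumeratesPairs hj.isRegular.aleph0_le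
  obtain ⟨p, hpM, hpH, h⟩ := hj.exists_mem
    (R := fun p _ (v : Fin 2 → ZFSet.{u}) => p ∈ v 0 ∧ EnumeratesPairs (v 1) p) inferInstance
    ![H (Order.succ κ), cardSet κ]
    (by simp [Fin.forall_fin_succ, hj.H_succ_mem, hj.isWeakModel.mem])
    ⟨p, H_subset_H hj.succ_le hp, hp, h⟩
  exact ⟨p, hpM, hj.mem_target hpM hpH, h⟩

theorem exists_isMembershipCode_target {k p : ZFSet.{u}} (hk : k ∈ N) (hp : p ∈ N) (hf : f ∈ N)
    (h : EnumeratesPairs k p) : ∃ e ∈ N, e ⊆ k ∧ IsMembershipCode k p e f := by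
  refine (hj.transfer (P := fun W (_ : Fin 0 → ZFSet.{u}) => ∀ k ∈ W, ∀ p ∈ W, ∀ f ∈ W,
    EnumeratesPairs k p → ∃ e ∈ W, e ⊆ k ∧ IsMembershipCode k p e f) inferInstance ![]
    (by simp)).1 (fun k hk p _ f _ h => ?_) k hk p hp f hf h
  obtain ⟨e, hek, he⟩ := h.exists_isMembershipCode f
  exact ⟨e, mem_H_of_subset hk hek, hek, he⟩

theorem enumerates_mem_of_isMembershipCode {p e : ZFSet.{u}} (hpM : p ∈ M) (heM : e ∈ M)
    (hp : EnumeratesPairs (cardSet κ) p) (he : Enumerates (cardSet κ) t f)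
    (hcode : IsMembershipCode (cardSet κ) p e f) : t ∈ M ∧ f ∈ M := by
  have cardSet_mem := hj.elemSub.subset hj.isWeakModel.mem
  have ht := he.mem_H_left cardSet_mem
  have hf := he.mem_H_right hj.isRegular_target cardSet_mem
  obtain ⟨t', ht', f', -, he', hcode'⟩ := hj.exists_mem
    (R := fun t W (v : Fin 3 → ZFSet.{u}) => ∃ f ∈ W, Enumerates (v 0) t f ∧
      IsMembershipCode (v 0) (v 1) (v 2) f) inferInstance
    ![cardSet κ, p, e] (by simp [Fin.forall_fin_succ, hj.isWeakModel.mem, heM, hpM])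
    ⟨t, ht, f, hf, he, hcode⟩
  obtain ⟨rfl, -⟩ := he.eq_of_isMembershipCode he' hp hcode hcode'
  obtain ⟨f', hf', he', hcode'⟩ := hj.exists_mem
    (R := fun f _ (v : Fin 4 → ZFSet.{u}) => Enumerates (v 0) (v 3) f ∧
      IsMembershipCode (v 0) (v 1) (v 2) f) inferInstance
    ![cardSet κ, p, e, t'] (by simp [Fin.forall_fin_succ, hj.isWeakModel.mem, heM, hpM, ht'])
    ⟨f, hf, he, hcode⟩
  obtain ⟨-, rfl⟩ := he.eq_of_isMembershipCode he' hp hcode hcode'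
  exact ⟨ht', hf'⟩

theorem enumerates_mem_of_target (hf : f ∈ N) (he : Enumerates (cardSet κ) t f) :
    t ∈ M ∧ f ∈ M := by
  obtain ⟨p, hpM, hpN, hp⟩ := hj.exists_enumeratesPairs_mem
  obtain ⟨e, heN, heκ, hcode⟩ :=
    hj.exists_isMembershipCode_target hj.cardSet_mem_target hpN hf hp
  have heM : e ∈ M := (hj.powersetPreserving.same_subsets e heκ).2 heN
  exact hj.enumerates_mem_of_isMembershipCode hpM heM hp he hcode

theorem eq_inter_of_isHSucc {X : ZFSet.{u}} (hX : X ∈ N) (h : IsHSucc N (cardSet κ) X) :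
    X = M ∩ H (Order.succ κ) := by
  ext y
  rw [ZFSet.mem_inter]
  constructor
  · intro hy
    obtain ⟨t, -, f, hfN, he, hyt⟩ := (h y (hj.isTransitive _ hX hy)).1 hy
    obtain ⟨ht, hf⟩ := hj.enumerates_mem_of_target hfN he
    exact ⟨hj.enumerates_subset ht hf he hyt,
      (mem_H_succ_iff hj.isRegular.aleph0_le).2 ⟨t, f, he, hyt⟩⟩
  · rintro ⟨hyM, hyH⟩
    obtain ⟨t, htM, f, hfM, he, hyt⟩ := hj.exists_enumerates hyM hyH
    obtain ⟨ht, hf⟩ := hj.enumerates_mem_target htM hfM he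
    exact (h y (hj.mem_target hyM hyH)).2 ⟨t, ht, f, hf, he, hyt⟩

theorem codes_mem : codes ∈ M := by
  have codes_mem := codes_mem_H hj.isRegular_target hj.aleph0_lt_target
  obtain ⟨F, hF, hclosed, hleast⟩ := hj.exists_mem
    (R := fun F W (_ : Fin 0 → ZFSet.{u}) => ClosedCodes F ∧ ∀ G ∈ W, ClosedCodes G → F ⊆ G)
    inferInstance ![] (by simp)
    ⟨codes, codes_mem, closedCodes_codes, fun _ _ hG => hG.codes_subset⟩
  rwa [hclosed.codes_subset.antisymm (hleast _ codes_mem closedCodes_codes)]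

theorem app_codes : app j codes = codes := by
  have codes_mem_H_succ := codes_mem_H (Cardinal.isRegular_succ hj.isRegular.aleph0_le)
    (Order.lt_succ_iff.2 hj.isRegular.aleph0_le)
  obtain ⟨hclosed, hleast⟩ := (hj.transfer
    (P := fun W (v : Fin 1 → ZFSet.{u}) => ClosedCodes (v 0) ∧ ∀ G ∈ W, ClosedCodes G → v 0 ⊆ G)
    inferInstance ![codes] (by simp [hj.codes_mem])).1
    ⟨closedCodes_codes, fun _ _ hG => hG.codes_subset⟩
  exact (hleast _ (hj.mem_target hj.codes_mem codes_mem_H_succ) closedCodes_codes).antisymm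
    hclosed.codes_subset

theorem exists_isSat_target :
    ∃ X ∈ N, ∃ D ∈ N, IsHSucc N (cardSet κ) X ∧ IsSat codes D X := by
  have transferred := (hj.transfer
    (P := fun W (v : Fin 2 → ZFSet.{u}) =>
      ∀ n ∈ v 0, ∃ X ∈ W, ∃ D ∈ W, IsHSucc W n X ∧ IsSat (v 1) D X) inferInstance
    ![cardSet κ, codes] (by simp [Fin.forall_fin_succ, hj.isWeakModel.mem, hj.codes_mem])).1
    (fun n hn => ?_) (cardSet κ) hj.cardSet_mem_app
  · simpa only [Matrix.cons_val_one, Matrix.cons_val_fin_one, hj.app_codes] using transferred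
  let X := ZFSet.sep (fun y => ∃ t ∈ H θ, ∃ f ∈ H θ, Enumerates n t f ∧ y ∈ t)
    (H (Order.succ κ))
  have X_mem : X ∈ H θ := mem_H_of_subset hj.H_succ_mem_H ZFSet.sep_subset
  have card_n_lt : n.card < Order.succ κ :=
    card_lt_of_mem_H (isTransitive_H _ (cardSet_mem_H (Order.lt_succ κ)) hn)
  refine ⟨X, X_mem, satSet X, satSet_mem_H hj.isRegular_target hj.aleph0_lt_target X_mem,
    fun y _ => ?_, isSat_satSet X⟩
  rw [ZFSet.mem_sep, and_iff_right_iff_imp]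
  rintro ⟨t, -, f, -, he, hyt⟩
  have t_mem := mem_H_of_isTransitive he.1 (he.card_le.trans_lt card_n_lt)
  exact isTransitive_H _ t_mem hyt

end IsRamseyEmbedding

/-! ### Super Ramsey cardinals inside a model -/

/-- A common generalization of super Ramsey cardinals, which are the case `κ ≤ α`, and super weakly
Ramsey cardinals: the weak `κ`-models are closed under `<α`-sequences of length less than `κ`. -/
def SuperAlphaRamsey (α κ : Cardinal.{u}) : Prop :=
  ∀ A : ZFSet.{u}, A ⊆ cardSet κ → ∃ M : ZFSet.{u}, A ∈ M ∧ IsWeakModel κ M ∧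
    ClosedUnderSeq (min α κ) M ∧ ElemSub M (H (Order.succ κ)) ∧ HasPowersetPreservingEmbedding κ M

theorem SuperAlphaRamsey.superRamsey {α κ : Cardinal.{u}} (h : SuperAlphaRamsey α κ)
    (hκ : κ ≤ α) : SuperRamsey κ := by
  intro A hA
  obtain ⟨M, hAM, hM, hc, hMH, hj⟩ := h A hA
  exact ⟨M, hAM, ⟨hM, min_eq_right hκ ▸ hc⟩, hMH, hj⟩

theorem SuperAlphaRamsey.superWeaklyRamsey {α κ : Cardinal.{u}} (h : SuperAlphaRamsey α κ) :
    SuperWeaklyRamsey κ := by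
  intro A hA
  obtain ⟨M, hAM, hM, -, hMH, hj⟩ := h A hA
  exact ⟨M, hAM, hM, hMH, hj⟩

theorem AlphaRamsey.superAlphaRamsey {α κ : Cardinal.{u}} (h : AlphaRamsey α κ) :
    SuperAlphaRamsey α κ := by
  intro A hA
  obtain ⟨θ, exists_isRamseyEmbedding⟩ := h.exists_isRamseyEmbedding
  obtain ⟨M, N, j, hj, hAM, hM⟩ := exists_isRamseyEmbedding A hA
  have hAH : A ∈ H (Order.succ κ) := mem_H_of_subset (cardSet_mem_H (Order.lt_succ κ)) hA
  have hακ : α ≤ κ := h.2.2.1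
  refine ⟨M ∩ H (Order.succ κ), ZFSet.mem_inter.2 ⟨hAM, hAH⟩, hj.isWeakModel_inter, ?_,
    hj.elemSub_inter, hj.hasPowersetPreservingEmbedding_inter⟩
  rw [min_eq_left hακ]
  exact hj.closedUnderSeq_inter hακ hM

/-- In the sense of `W`, the ordinal `n` is a cardinal. -/
def IsCardinalIn (W n : ZFSet.{u}) : Prop :=
  ∀ a ∈ n, ∀ f ∈ W, ZFSet.IsFunc a n f → ¬ ∀ y ∈ n, ∃ x ∈ a, ZFSet.pair x y ∈ f

/-- In the sense of `X`, the set `M` is closed under sequences whose length is in `n ∩ a`. -/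
def IsClosedUnderSeqIn (X n a M : ZFSet.{u}) : Prop :=
  ∀ β ∈ n, β ∈ a → ∀ f ∈ X, ZFSet.IsFunc β M f → f ∈ M

/-- The Tarski–Vaught criterion for `M ≺ X`, where `F` is the set of codes of formulas and `D` is
the satisfaction relation of `X`. -/
def IsElemSubIn (F D M X : ZFSet.{u}) : Prop :=
  ∀ c ∈ F, ∀ t ∈ M, (∃ x ∈ X, ZFSet.pair c (ZFSet.pair t x) ∈ D) →
    ∃ x ∈ M, ZFSet.pair c (ZFSet.pair t x) ∈ D

/-- The function `j : M → N` is an elementary embedding, where `F` is the set of codes of formulas,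
`D` agrees on `M` with the satisfaction relation of `M`, and `E` is that of `N`. -/
def IsElemMapIn (F D E M N j : ZFSet.{u}) : Prop :=
  PairClosed N ∧ IsSat F E N ∧ ZFSet.IsFunc M N j ∧
    (∀ x ∈ M, ∀ y ∈ M, ZFSet.pair (ZFSet.pair x y) (ZFSet.pair (val j x) (val j y)) ∈ j) ∧
    ∀ c ∈ F, ∀ t ∈ M, ZFSet.pair c t ∈ D ↔ ZFSet.pair c (val j t) ∈ E

/-- In the sense of `X`, the function `j : M → N` has critical point `n` and preserves the subsets
of `n`. -/
def IsPowersetPreservingIn (X n M N j : ZFSet.{u}) : Prop :=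
  (∀ x ∈ n, x = val j x) ∧ n ≠ val j n ∧ ∀ B ∈ X, B ⊆ n → (B ∈ M ↔ B ∈ N)

/-- For `A ⊆ n`, the sets `M`, `N` and `j` are as required by the definition of super `α`-Ramsey
cardinals, in the sense of `X = H(n⁺)`; here `a` stands for `α`, the set `F` consists of the codes
of formulas, and `D` and `E` are the satisfaction relations of `X` and `N`. -/
def IsRamseyWitness (n a X F D A M N j E : ZFSet.{u}) : Prop :=
  (A ∈ M ∧ n ⊆ M ∧ n ∈ M) ∧ (M.IsTransitive ∧ N.IsTransitive ∧ PairClosed M) ∧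
    IsClosedUnderSeqIn X n a M ∧ IsElemSubIn F D M X ∧ IsElemMapIn F D E M N j ∧
    IsPowersetPreservingIn X n M N j

/-- In the sense of `W`, the ordinal `n` is a super `α`-Ramsey cardinal, where `a` stands for `α`
and `F` is the set of codes of formulas. -/
def IsSuperAlphaRamseyIn (W n a F : ZFSet.{u}) : Prop :=
  IsCardinalIn W n ∧ ∃ X ∈ W, ∃ D ∈ W, IsHSucc W n X ∧ IsSat F D X ∧ ∀ A ∈ X, A ⊆ n →
    ∃ M ∈ X, ∃ N ∈ X, ∃ j ∈ X, ∃ E ∈ X, IsRamseyWitness n a X F D A M N j E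

instance UniformlyDefinable.isElemMapIn {α : Type} {F D E M N j : α} :
    UniformlyDefinable
      (fun (_ : ZFSet.{u}) v => IsElemMapIn (v F) (v D) (v E) (v M) (v N) (v j)) := by
  unfold IsElemMapIn
  infer_instance

instance UniformlyDefinable.isRamseyWitness {α : Type} {n a X F D A M N j E : α} :
    UniformlyDefinable (fun (_ : ZFSet.{u}) v => IsRamseyWitness (v n) (v a) (v X) (v F) (v D)
      (v A) (v M) (v N) (v j) (v E)) := by
  unfold IsRamseyWitness IsClosedUnderSeqIn IsElemSubIn IsPowersetPreservingIn
  infer_instance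

instance UniformlyDefinable.isSuperAlphaRamseyIn {α : Type} {n a F : α} :
    UniformlyDefinable
      (fun (W : ZFSet.{u}) v => IsSuperAlphaRamseyIn W (v n) (v a) (v F)) := by
  unfold IsSuperAlphaRamseyIn IsCardinalIn
  infer_instance

theorem isCardinalIn_cardSet (W : ZFSet.{u}) (κ : Cardinal.{u}) : IsCardinalIn W (cardSet κ) := by
  intro a ha f _ hf hsurj
  obtain ⟨β, hβ, rfl⟩ := Ordinal.mem_toZFSet_iff.1 ha
  have card_le : (cardSet κ).card ≤ β.toZFSet.card := by
    refine card_le_of_surj (val f) fun y hy => ?_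
    obtain ⟨x, hx, hxy⟩ := hsurj y hy
    exact ⟨x, hx, ((pair_mem_iff_of_isFunc hf hx).1 hxy).symm⟩
  rw [card_cardSet, Ordinal.card_toZFSet] at card_le
  exact (Cardinal.lt_ord.1 hβ).not_ge card_le

theorem IsCardinalIn.eq_cardSet {θ : Cardinal.{u}} (hθ : θ.IsRegular) {o : Ordinal.{u}}
    (ho : o.card < θ) (h : IsCardinalIn (H θ) o.toZFSet) : o.toZFSet = cardSet o.card := by
  rw [cardSet, Ordinal.toZFSet_injective.eq_iff]
  refine le_antisymm (not_lt.1 fun hlt => ?_) (Cardinal.ord_card_le o)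
  have o_mem := toZFSet_mem_H ho
  have ord_mem := Ordinal.toZFSet_mem_toZFSet_iff.2 hlt
  obtain ⟨F, mapsTo, surj⟩ := exists_surj_of_card_le (k := o.card.ord.toZFSet) (t := o.toZFSet)
    (by simp) ⟨_, ord_mem⟩
  have graph_mem := graph_mem_H hθ (isTransitive_H _ o_mem ord_mem)
    fun a ha => isTransitive_H _ o_mem (mapsTo a ha)
  refine h _ ord_mem _ graph_mem (isFunc_graph mapsTo) fun y hy => ?_
  obtain ⟨a, ha, rfl⟩ := surj y hy
  exact ⟨a, ha, pair_mem_graph.2 ⟨ha, rfl⟩⟩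

theorem isClosedUnderSeqIn_iff {α ν : Cardinal.{u}} {M : ZFSet.{u}} (hν : Cardinal.aleph0 ≤ ν)
    (hM : M ⊆ H (Order.succ ν)) :
    IsClosedUnderSeqIn (H (Order.succ ν)) (cardSet ν) (cardSet α) M ↔
      ClosedUnderSeq (min α ν) M := by
  constructor
  · intro h β hβ f hf
    obtain ⟨hβα, hβν⟩ := lt_min_iff.1 (Cardinal.lt_ord.1 hβ)
    exact h _ (Ordinal.toZFSet_mem_toZFSet_iff.2 (Cardinal.lt_ord.2 hβν))
      (Ordinal.toZFSet_mem_toZFSet_iff.2 (Cardinal.lt_ord.2 hβα)) f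
      (isFunc_mem_H (Cardinal.isRegular_succ hν) (toZFSet_mem_H (hβν.trans (Order.lt_succ ν)))
        hM hf) hf
  · intro h x hxν hxα f _ hf
    obtain ⟨β, hβν, rfl⟩ := Ordinal.mem_toZFSet_iff.1 hxν
    have hβα := Ordinal.toZFSet_mem_toZFSet_iff.1 hxα
    exact h β (Cardinal.lt_ord.2 (lt_min (Cardinal.lt_ord.1 hβα) (Cardinal.lt_ord.1 hβν))) f hf

section

variable {M N X Y D E F j : ZFSet.{u}}

theorem IsSat.iff_of_elemSub (hD : IsSat codes D X) (h : ElemSub M X) (hX : X.IsTransitive)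
    (hM : M.IsTransitive) (c : Code) {t : ZFSet.{u}} (ht : t ∈ M) :
    ZFSet.pair c.toZFSet t ∈ D ↔ sat M c t :=
  (hD.iff closedCodes_codes c t (h.subset ht)).trans
    (h.iff_of_isTransitive (P := fun W (v : Fin 1 → ZFSet.{u}) => sat W c (v 0)) inferInstance
      hX hM ![t] (by simp [ht]))

theorem isElemSubIn_iff (hD : IsSat codes D X) (hX : X.IsTransitive) (hXp : PairClosed X)
    (hMX : M ⊆ X) (hMp : PairClosed M) : IsElemSubIn codes D M X ↔ ElemSub M X := by
  have sat_iff {t x : ZFSet.{u}} (c : Code) (ht : t ∈ M) (hx : x ∈ X) :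
      ZFSet.pair c.toZFSet (ZFSet.pair t x) ∈ D ↔ sat X c (ZFSet.pair t x) :=
    hD.iff closedCodes_codes c _ (hXp.2 t (hMX ht) x hx)
  constructor
  · refine fun h => elemSub_of_sat hMX hMp hXp fun c t ht ⟨x, hx, h_sat⟩ => ?_
    obtain ⟨y, hy, hyD⟩ := h _ (closedCodes_codes.toZFSet_mem c) t ht
      ⟨x, hx, (sat_iff c ht hx).2 h_sat⟩
    exact ⟨y, hy, (sat_iff c ht (hMX hy)).1 hyD⟩
  · rintro h c hc t ht ⟨x, hx, hxD⟩
    obtain ⟨c, rfl⟩ := mem_codes.1 hc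
    obtain ⟨y, hy, _, -, rfl, h_sat⟩ := h.exists_mem hX
      (R := fun x W (v : Fin 1 → ZFSet.{u}) => ∃ w ∈ W, w = ZFSet.pair (v 0) x ∧ sat W c w)
      inferInstance ![t] (by simp [ht])
      ⟨x, hx, _, hXp.2 t (hMX ht) x hx, rfl, (sat_iff c ht hx).1 hxD⟩
    exact ⟨y, hy, (sat_iff c ht (hMX hy)).2 h_sat⟩

theorem PairClosed.target (hMp : PairClosed M) (hM : M.IsTransitive) (hN : N.IsTransitive)
    (j : M ↪ₑ[setLang] N) : PairClosed N := by
  obtain ⟨⟨e, he, empty⟩, pair⟩ := (UniformlyDefinable.transfer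
    (P := fun W (_ : Fin 0 → ZFSet.{u}) => (∃ e ∈ W, e = ∅) ∧
      ∀ x ∈ W, ∀ y ∈ W, ∃ p ∈ W, p = ZFSet.pair x y) inferInstance (ElemSub.refl M) hM hN j ![]
    (by simp)).1 ⟨⟨_, hMp.1, rfl⟩, fun x hx y hy => ⟨_, hMp.2 x hx y hy, rfl⟩⟩
  refine ⟨empty ▸ he, fun x hx y hy => ?_⟩
  obtain ⟨p, hp, rfl⟩ := pair x hx y hy
  exact hp

theorem isElemMapIn_graph (hMp : PairClosed M) (hM : M.IsTransitive) (hN : N.IsTransitive)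
    (j : M ↪ₑ[setLang] N)
    (hD : ∀ (c : Code), ∀ t ∈ M, ZFSet.pair c.toZFSet t ∈ D ↔ sat M c t) :
    IsElemMapIn codes D (satSet N) M N (graph M (app j)) := by
  refine ⟨hMp.target hM hN j, isSat_satSet N, isFunc_graph fun x hx => app_mem j hx,
    fun x hx y hy => ?_, fun c hc t ht => ?_⟩
  · have app_pair : app j (ZFSet.pair x y) = ZFSet.pair (app j x) (app j y) :=
      (UniformlyDefinable.transfer
        (P := fun _ (v : Fin 3 → ZFSet.{u}) => v 0 = ZFSet.pair (v 1) (v 2)) inferInstance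
        (ElemSub.refl M) hM hN j ![ZFSet.pair x y, x, y]
        (by simp [Fin.forall_fin_succ, hx, hy, hMp.2 x hx y hy])).1 rfl
    rw [pair_mem_graph, val_graph hx, val_graph hy]
    exact ⟨hMp.2 x hx y hy, app_pair.symm⟩
  · obtain ⟨c, rfl⟩ := mem_codes.1 hc
    rw [hD c t ht, val_graph ht, pair_mem_satSet, and_iff_right (app_mem j ht)]
    exact UniformlyDefinable.transfer (P := fun W (v : Fin 1 → ZFSet.{u}) => sat W c (v 0))
      inferInstance (ElemSub.refl M) hM hN j ![t] (by simp [ht])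

theorem IsElemMapIn.exists_elementaryEmbedding (h : IsElemMapIn codes D E M N j)
    (hMp : PairClosed M) (map_empty : val j ∅ = ∅)
    (hD : ∀ (c : Code), ∀ t ∈ M, ZFSet.pair c.toZFSet t ∈ D ↔ sat M c t) :
    ∃ i : M ↪ₑ[setLang] N, ∀ x : M, (i x : ZFSet.{u}) = val j x := by
  obtain ⟨hNp, hE, isFunc, map_pair, map_sat⟩ := h
  refine exists_elementaryEmbedding_of_sat hMp hNp (val j) (fun x hx => val_mem isFunc hx)
    map_empty (fun x hx y hy => ?_) fun c t ht => ?_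
  · exact ((pair_mem_iff_of_isFunc isFunc (hMp.2 x hx y hy)).1 (map_pair x hx y hy)).symm
  · rw [← hD c t ht, map_sat _ (closedCodes_codes.toZFSet_mem c) t ht,
      hE.iff closedCodes_codes c _ (val_mem isFunc ht)]

theorem IsRamseyWitness.restrict {n a a' A D' : ZFSet.{u}}
    (h : IsRamseyWitness n a' X F D' A M N j E) (hYX : Y ⊆ X) (hYp : PairClosed Y) (hMY : M ⊆ Y)
    (ha : ∀ β ∈ n, β ∈ a → β ∈ a')
    (hD : ∀ c ∈ F, ∀ t ∈ Y, ZFSet.pair c t ∈ D' ↔ ZFSet.pair c t ∈ D) :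
    IsRamseyWitness n a Y F D A M N j E := by
  obtain ⟨mem, isTransitive, closed, elemSub, ⟨hNp, hE, isFunc, map_pair, map_sat⟩,
    fixes, moves, same_subsets⟩ := h
  refine ⟨mem, isTransitive, fun β hβ hβa f hf => closed β hβ (ha β hβ hβa) f (hYX hf), ?_,
    ⟨hNp, hE, isFunc, map_pair, fun c hc t ht => ?_⟩,
    fixes, moves, fun B hB => same_subsets B (hYX hB)⟩
  · rintro c hc t ht ⟨x, hx, hxD⟩
    obtain ⟨y, hy, hyD⟩ := elemSub c hc t ht
      ⟨x, hYX hx, (hD c hc _ (hYp.2 t (hMY ht) x hx)).2 hxD⟩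
    exact ⟨y, hy, (hD c hc _ (hYp.2 t (hMY ht) y (hMY hy))).1 hyD⟩
  · rw [← hD c hc t (hMY ht), map_sat c hc t ht]

end

theorem SuperAlphaRamsey.exists_isRamseyWitness {α κ : Cardinal.{u}} {A D : ZFSet.{u}}
    (h : SuperAlphaRamsey α κ) (hκ : Cardinal.aleph0 < κ) (hA : A ⊆ cardSet κ)
    (hD : IsSat codes D (H (Order.succ κ))) :
    ∃ M ∈ H (Order.succ κ), ∃ N ∈ H (Order.succ κ), ∃ j ∈ H (Order.succ κ),
      ∃ E ∈ H (Order.succ κ),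
        IsRamseyWitness (cardSet κ) (cardSet α) (H (Order.succ κ)) codes D A M N j E := by
  have hr := Cardinal.isRegular_succ hκ.le
  obtain ⟨M, hAM, hM, hMc, hMH, N', hN', j', hj'⟩ := h A hA
  obtain ⟨N, hN, hNc, j, hj⟩ := hj'.exists_small hκ.le hM.card_eq hM.mem hM.subset hN'
  have hMt := hMH.isTransitive hκ.le hM.mem hM.subset
  have M_mem : M ∈ H (Order.succ κ) :=
    mem_H_of_isTransitive hMt (hM.card_eq.trans_lt (Order.lt_succ κ))
  have N_mem : N ∈ H (Order.succ κ) := mem_H_of_isTransitive hN (Order.lt_succ_of_le hNc)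
  have graph_mem : graph M (app j) ∈ H (Order.succ κ) :=
    graph_mem_H hr M_mem fun x hx => isTransitive_H _ N_mem (app_mem j hx)
  have hMp : PairClosed M :=
    ⟨hM.subset (empty_mem_cardSet hκ.le), fun x hx y hy => hMH.pair_mem hr hx hy⟩
  refine ⟨M, M_mem, N, N_mem, graph M (app j), graph_mem, satSet N,
    satSet_mem_H hr (hκ.trans (Order.lt_succ κ)) N_mem,
    ⟨hAM, hM.subset, hM.mem⟩, ⟨hMt, hN, hMp⟩, (isClosedUnderSeqIn_iff hκ.le hMH.subset).2 hMc,
    (isElemSubIn_iff hD isTransitive_H (pairClosed_H hr) hMH.subset hMp).2 hMH,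
    isElemMapIn_graph hMp hMt hN j fun c t ht => hD.iff_of_elemSub hMH isTransitive_H hMt c ht,
    fun x hx => ?_, fun h => ?_, fun B _ => hj.same_subsets B⟩
  · rw [val_graph (hM.subset hx), app_of_mem j (hM.subset hx)]
    exact (hj.fixes ⟨x, hM.subset hx⟩ hx).symm
  · obtain ⟨x, hx, hne⟩ := hj.moves
    rw [← hx, val_graph x.2, app_of_mem j x.2] at h
    exact hne h.symm

theorem IsRamseyWitness.exists_model {α ν : Cardinal.{u}} {A D M N j E : ZFSet.{u}}
    (h : IsRamseyWitness (cardSet ν) (cardSet α) (H (Order.succ ν)) codes D A M N j E)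
    (hν : Cardinal.aleph0 < ν) (hD : IsSat codes D (H (Order.succ ν)))
    (hM : M ∈ H (Order.succ ν)) :
    IsWeakModel ν M ∧ ClosedUnderSeq (min α ν) M ∧ ElemSub M (H (Order.succ ν)) ∧
      HasPowersetPreservingEmbedding ν M := by
  have hr := Cardinal.isRegular_succ hν.le
  have hMX := isTransitive_H _ hM
  obtain ⟨⟨-, subset, mem⟩, ⟨hMt, hN, hMp⟩, closed, elemSub, elemMap, fixes, moves,
    same_subsets⟩ := h
  have hMH := (isElemSubIn_iff hD isTransitive_H (pairClosed_H hr) hMX hMp).1 elemSub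
  obtain ⟨i, hi⟩ := elemMap.exists_elementaryEmbedding hMp
    (fixes ∅ (empty_mem_cardSet hν.le)).symm
    fun c t ht => hD.iff_of_elemSub hMH isTransitive_H hMt c ht
  refine ⟨⟨le_antisymm ?_ ?_, subset, mem,
    hMH.modelsZFCMinus hr (hν.trans (Order.lt_succ ν)) hMt⟩,
    (isClosedUnderSeqIn_iff hν.le hMX).1 closed, hMH, N, hN, i, fun x hx => ?_,
    ⟨⟨cardSet ν, mem⟩, rfl, fun h => ?_⟩, fun B hB => ?_⟩
  · exact Order.lt_succ_iff.1 (card_lt_of_mem_H hM)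
  · exact (card_cardSet ν).symm.le.trans (ZFSet.card_mono subset)
  · rw [hi, ← fixes _ hx]
  · exact moves ((hi _).symm.trans h).symm
  · exact same_subsets B (mem_H_of_subset (cardSet_mem_H (Order.lt_succ ν)) hB) hB

theorem IsSuperAlphaRamseyIn.superAlphaRamsey {α ν θ : Cardinal.{u}}
    (h : IsSuperAlphaRamseyIn (H θ) (cardSet ν) (cardSet α) codes) (hν : Cardinal.aleph0 < ν)
    (hνθ : Order.succ ν ≤ θ) (hH : H (Order.succ ν) ∈ H θ) : SuperAlphaRamsey α ν := by
  obtain ⟨-, X, hX, D, -, isHSucc, hD, h⟩ := h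
  obtain rfl := isHSucc_unique isTransitive_H hX hH isHSucc (isHSucc_H hν.le hνθ)
  intro A hA
  obtain ⟨M, hM, N, -, j, -, E, -, witness⟩ := h A
    (mem_H_of_subset (cardSet_mem_H (Order.lt_succ ν)) hA) hA
  exact ⟨M, witness.1.1, witness.exists_model hν hD hM⟩

namespace IsRamseyEmbedding

variable {α κ θ : Cardinal.{u}} {M N : ZFSet.{u}} {j : M ↪ₑ[setLang] N}
  (hj : IsRamseyEmbedding κ θ j)
include hj

theorem cardSet_mem_of_le (hα : α ≤ κ) : cardSet α ∈ M := by
  rcases hα.lt_or_eq with hlt | rfl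
  · exact hj.isWeakModel.subset (cardSet_mem_cardSet.2 hlt)
  · exact hj.isWeakModel.mem

theorem exists_isRamseyWitness_inter {A D : ZFSet.{u}} (h : SuperAlphaRamsey α κ) (hα : α ≤ κ)
    (hA : A ∈ M) (hAκ : A ⊆ cardSet κ) (hDM : D ∈ M) (hD : IsSat codes D (H (Order.succ κ))) :
    ∃ P ∈ M ∩ H (Order.succ κ), ∃ Q ∈ M ∩ H (Order.succ κ), ∃ i ∈ M ∩ H (Order.succ κ),
      ∃ E ∈ M ∩ H (Order.succ κ),
        IsRamseyWitness (cardSet κ) (cardSet α) (H (Order.succ κ)) codes D A P Q i E := by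
  have hr := Cardinal.isRegular_succ hj.isRegular.aleph0_le
  obtain ⟨P, hP, Q, hQ, i, hi, E, hE, witness⟩ :=
    h.exists_isRamseyWitness hj.aleph0_lt hAκ hD
  obtain ⟨w, hwM, hw, P, -, Q, -, i, -, E, -, rfl, witness⟩ := hj.exists_mem
    (R := fun w _ (v : Fin 6 → ZFSet.{u}) => w ∈ v 0 ∧ ∃ P ∈ v 0, ∃ Q ∈ v 0, ∃ i ∈ v 0, ∃ E ∈ v 0,
      w = ZFSet.pair (ZFSet.pair P Q) (ZFSet.pair i E) ∧
        IsRamseyWitness (v 1) (v 2) (v 0) (v 3) (v 4) (v 5) P Q i E) inferInstance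
    ![H (Order.succ κ), cardSet κ, cardSet α, codes, D, A]
    (by simp [Fin.forall_fin_succ, hj.H_succ_mem, hj.isWeakModel.mem, hj.cardSet_mem_of_le hα,
      hj.codes_mem, hDM, hA])
    ⟨_, H_subset_H hj.succ_le (pair_mem_H hr (pair_mem_H hr hP hQ) (pair_mem_H hr hi hE)),
      pair_mem_H hr (pair_mem_H hr hP hQ) (pair_mem_H hr hi hE),
      P, hP, Q, hQ, i, hi, E, hE, rfl, witness⟩
  obtain ⟨hPQ, hiE⟩ := mem_of_pair_mem hj.isTransitive_inter (ZFSet.mem_inter.2 ⟨hwM, hw⟩)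
  obtain ⟨hP, hQ⟩ := mem_of_pair_mem hj.isTransitive_inter hPQ
  obtain ⟨hi, hE⟩ := mem_of_pair_mem hj.isTransitive_inter hiE
  exact ⟨P, hP, Q, hQ, i, hi, E, hE, witness⟩

theorem isSuperAlphaRamseyIn_target (h : SuperAlphaRamsey α κ) (hα : α ≤ κ) :
    IsSuperAlphaRamseyIn N (cardSet κ) (app j (cardSet α)) codes := by
  have hr := Cardinal.isRegular_succ hj.isRegular.aleph0_le
  obtain ⟨X, hX, D, hD, isHSucc, isSat⟩ := hj.exists_isSat_target
  obtain rfl := hj.eq_inter_of_isHSucc hX isHSucc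
  refine ⟨isCardinalIn_cardSet _ _, _, hX, D, hD, isHSucc, isSat, fun A hA hAκ => ?_⟩
  obtain ⟨D', hD', isSat'⟩ : ∃ D' ∈ M, IsSat codes D' (H (Order.succ κ)) := hj.exists_mem
    (R := fun D _ (v : Fin 2 → ZFSet.{u}) => IsSat (v 0) D (v 1)) inferInstance
    ![codes, H (Order.succ κ)] (by simp [Fin.forall_fin_succ, hj.codes_mem, hj.H_succ_mem])
    ⟨_, satSet_mem_H hj.isRegular_target hj.aleph0_lt_target hj.H_succ_mem_H, isSat_satSet _⟩
  obtain ⟨P, hP, Q, hQ, i, hi, E, hE, witness⟩ :=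
    hj.exists_isRamseyWitness_inter h hα (ZFSet.mem_inter.1 hA).1 hAκ hD' isSat'
  refine ⟨P, hP, Q, hQ, i, hi, E, hE, witness.restrict hj.elemSub_inter.subset ?_
    (hj.isTransitive_inter _ hP)
    (fun β hβ => (hj.mem_app_iff hβ (hj.cardSet_mem_of_le hα)).1) fun c hc t ht => ?_⟩
  · exact ⟨hj.isWeakModel_inter.subset (empty_mem_cardSet hj.isRegular.aleph0_le),
      fun x hx y hy => hj.elemSub_inter.pair_mem hr hx hy⟩
  · obtain ⟨c, rfl⟩ := mem_codes.1 hc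
    rw [isSat.iff closedCodes_codes c t ht]
    exact isSat'.iff_of_elemSub hj.elemSub_inter isTransitive_H hj.isTransitive_inter c ht

theorem exists_isSuperAlphaRamseyIn (h : SuperAlphaRamsey α κ) (hα : α ≤ κ) {m : ZFSet.{u}}
    (hm : m ∈ cardSet κ) :
    ∃ n ∈ cardSet κ, m ∈ n ∧ IsSuperAlphaRamseyIn (H θ) n (cardSet α) codes := by
  refine (hj.transfer (P := fun W (v : Fin 4 → ZFSet.{u}) => ∃ n ∈ v 0, v 1 ∈ n ∧
    IsSuperAlphaRamseyIn W n (v 2) (v 3)) inferInstance ![cardSet κ, m, cardSet α, codes]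
    (by simp [Fin.forall_fin_succ, hj.codes_mem, hj.isWeakModel.mem, hj.isWeakModel.subset hm,
      hj.cardSet_mem_of_le hα])).2 ⟨cardSet κ, hj.cardSet_mem_app, ?_, ?_⟩
  · change app j m ∈ cardSet κ
    rwa [hj.app_eq_self hm]
  · change IsSuperAlphaRamseyIn N (cardSet κ) (app j (cardSet α)) (app j codes)
    rw [hj.app_codes]
    exact hj.isSuperAlphaRamseyIn_target h hα

end IsRamseyEmbedding

theorem AlphaRamsey.isLimitOf_superAlphaRamsey {α κ : Cardinal.{u}} (h : AlphaRamsey α κ) :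
    IsLimitOf (SuperAlphaRamsey α) κ := by
  have hακ : α ≤ κ := h.2.2.1
  obtain ⟨θ, exists_isRamseyEmbedding⟩ := h.exists_isRamseyEmbedding
  obtain ⟨M, N, j, hj, -, -⟩ := exists_isRamseyEmbedding ∅ (ZFSet.empty_subset _)
  intro μ hμ
  obtain ⟨x, hx, max_mem, hxR⟩ := hj.exists_isSuperAlphaRamseyIn h.superAlphaRamsey hακ
    (cardSet_mem_cardSet.2 (max_lt hμ hj.aleph0_lt))
  obtain ⟨o, ho, rfl⟩ := Ordinal.mem_toZFSet_iff.1 hx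
  have card_lt : o.card < θ := (Cardinal.lt_ord.1 ho).trans (Order.succ_le_iff.1 hj.succ_le)
  rw [hxR.1.eq_cardSet hj.isRegular_target card_lt] at hx max_mem hxR
  rw [cardSet_mem_cardSet] at hx max_mem
  obtain ⟨hμν, aleph0_lt⟩ := max_lt_iff.1 max_mem
  have succ_le : Order.succ o.card ≤ Order.succ κ := Order.succ_le_succ hx.le
  exact ⟨o.card, hμν, hx, hxR.superAlphaRamsey aleph0_lt (succ_le.trans hj.succ_le)
    (mem_H_of_subset hj.H_succ_mem_H (H_subset_H succ_le))⟩

theorem IsLimitOf.imp {P Q : Cardinal.{u} → Prop} {κ : Cardinal.{u}} (h : IsLimitOf P κ)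
    (hPQ : ∀ ν < κ, P ν → Q ν) : IsLimitOf Q κ := by
  intro μ hμ
  obtain ⟨ν, hμν, hνκ, hν⟩ := h μ hμ
  exact ⟨ν, hμν, hνκ, hPQ ν hνκ hν⟩

end RamseyLike

theorem proposition5p2_general {α κ : Cardinal.{u}} (h : RamseyLike.AlphaRamsey α κ) :
    RamseyLike.SuperAlphaRamsey α κ ∧
      RamseyLike.IsLimitOf (RamseyLike.SuperAlphaRamsey α) κ :=
  ⟨h.superAlphaRamsey, h.isLimitOf_superAlphaRamsey⟩

theorem proposition5p2 :
    (∀ κ : Cardinal.{u}, RamseyLike.AlphaRamsey κ κ →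
      RamseyLike.SuperRamsey κ ∧ RamseyLike.IsLimitOf RamseyLike.SuperRamsey κ) ∧
    (∀ κ : Cardinal.{u}, RamseyLike.AlphaRamsey Cardinal.aleph0.{u} κ →
      RamseyLike.SuperWeaklyRamsey κ ∧
        RamseyLike.IsLimitOf RamseyLike.SuperWeaklyRamsey κ) := by
  refine ⟨fun κ h => ?_, fun κ h => ?_⟩
  · obtain ⟨hκ, limit⟩ := proposition5p2_general h
    exact ⟨hκ.superRamsey le_rfl, limit.imp fun ν hν hR => hR.superRamsey hν.le⟩
  · obtain ⟨hκ, limit⟩ := proposition5p2_general h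
    exact ⟨hκ.superWeaklyRamsey, limit.imp fun ν _ hR => hR.superWeaklyRamsey⟩
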